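/- **Notation.** Let $\tau\in\mathbb{C}$ with $\operatorname{Im}\tau>0$ and $u\in\mathbb{C}$; put $q=e^{2\pi i\tau}$, $z=e^{2\pi iu}$, and for complex $a$ put $q^a=e^{2\pi i a\tau}$, $z^a=e^{2\pi i a u}$. For $0<|Q|<1$ and $x\neq 0$ let $(x;Q)_\infty=\prod_{i\ge 0}(1-Q^ix)$, $(q)_\infty=(q;q)_\infty$, $$j(x;Q)=(x;Q)_\infty(Q/x;Q)_\infty(Q;Q)_\infty,\qquad m(x,y;Q)=\frac{1}{j(y;Q)}\sum_{n\in\mathbb{Z}}\frac{(-1)^nQ^{\binom n2}y^n}{1-Q^{n-1}xy},$$ where $m(x,y;Q)$ is defined when neither $y$ nor $xy$ is an integral power of $Q$. (The symbol $j$ with two arguments is the theta function; otherwise $j$ is an integer.) Let $\Theta_{n,m}(z;q)=\sum_{a\in\mathbb{Z}+n/2m}q^{ma^2}z^{-ma}$. For coprime integers $p\ge1$, $p'\ge2$ and $0\le\ell\le p'-2$, the admissible $A_1^{(1)}$ character of level $N=p'/p-2$ and spin $\ell$ is $$\chi_\ell^{(p,p')}(z;q)=\frac{\Theta_{\ell+1,p'}(z;q^p)-\Theta_{-\ell-1,p'}(z;q^p)}{\Theta_{1,2}(z;q)-\Theta_{-1,2}(z;q)}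 .$$ For $N\ne0$ and $m\in 2\mathbb{Z}+\ell$, the string function $C_{m,\ell}^{(p,p')}(q)$ is defined by letting $C_{m,\ell}^{(p,p')}(q)\,q^{m^2/4N}$ be the coefficient of $z^{-m/2}$ in the Laurent expansion of $\chi_\ell^{(p,p')}(z;q)$ in the annulus $|q|<|z|<|q|^{-1}$ (the singularity at $z=1$ is removable), that is, $$C_{m,\ell}^{(p,p')}(q)=q^{-\frac{m^2}{4N}}\int_0^1\chi_\ell^{(p,p')}(e^{2\pi ix};q)\,e^{\pi i m x}\,dx .$$ **Theorem.** Let $p,j\ge1$ be integers with $\gcd(p,2p+j)=1$, and let $r\ge0$ be an integer with $2r+1\le 2p+j-2$. Then: (i) for $|q|<|z|<|q|^{-1}$, $z\ne1$, $$\chi_{2r+1}^{(p,2p+j)}(z;q)=\sum_{k\in\mathbb{Z}}C_{2k+1,2r+1}^{(p,2p+j)}(q)\,q^{\frac{p}{4j}(2k+1)^2}z^{-\frac12(2k+1)},$$ with convergence of the series; (ii) for every $z=e^{2\pi i u}$ which is not an integral power of $q$ and for which all Appell functions below are defined, $$\begin{aligned} \chi_{2r+1}^{(p,2p+j)}(z;q)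 &=\sum_{s=0}^{j-1}z^{-\frac12(2s+1)}q^{\frac{p}{4j}(2s+1)^2}C_{2s+1,2r+1}^{(p,2p+j)}(q)\,j(-z^{j}q^{p(j-2s-1)};q^{2pj})\\ &\quad+\frac{1}{(q)_\infty^3}\sum_{s=0}^{j-1}(-1)^pq^{-\frac18+\frac{p(2r+2)^2}{4(2p+j)}}q^{\binom p2-p(r-s)}z^{-\frac12(2s+1)}j(-q^{p(j-2s-1)}z^{j};q^{2jp})\\ &\qquad\times\sum_{m=1}^{p-1}(-1)^mq^{\binom{m+1}2+m(r-p)}\\ &\qquad\times\Big(j(-q^{m(2p+j)+p(2r+2)};q^{2p(2p+j)})-q^{m(2p+j)-m(2r+2)}j(-q^{-m(2p+j)+p(2r+2)};q^{2p(2p+j)})\Big)\\ &\qquad\times\Big(q^{m(s+1)-p(2s+1)}m(-q^{jm-p(2s+1)},-q^{p(j+2s+1)}z^{-j};q^{2jp})\\ &\qquad\qquad+q^{-ms}m(-q^{jm+p(2s+1)},-q^{p(j-2s-1)}z^{j};q^{2jp})\Big). \end{aligned}$$ -/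

import Mathlib

open Complex Finset

noncomputable section

/-- `epow t a = exp (2 π i a t)`. With `q = exp (2 π i τ)` and `z = exp (2 π i u)`, the (possibly
fractional) powers `q ^ a` and `z ^ a` are `epow τ a` and `epow u a`. -/
def epow (t a : ℂ) : ℂ := Complex.exp (2 * Real.pi * Complex.I * a * t)

/-- The infinite `q`-Pochhammer symbol `(x; q)_∞ = ∏_{i ≥ 0} (1 - q ^ i x)`. -/
def qPochInf (x q : ℂ) : ℂ := ∏' i : ℕ, (1 - q ^ i * x)

/-- The theta function `j(x; q) = (x; q)_∞ (q / x; q)_∞ (q; q)_∞`. -/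
def jTheta (x q : ℂ) : ℂ := qPochInf x q * qPochInf (q / x) q * qPochInf q q

/-- The Appell function
`m(x, z; q) = j(z; q)⁻¹ ∑_{r ∈ ℤ} (-1) ^ r q ^ (r (r - 1) / 2) z ^ r / (1 - q ^ (r - 1) x z)`. -/
def appellM (x z q : ℂ) : ℂ :=
  (1 / jTheta z q) *
    ∑' r : ℤ, (-1 : ℂ) ^ r * q ^ (r * (r - 1) / 2) * z ^ r / (1 - q ^ (r - 1) * x * z)

/-- No denominator in the definition of `m(x, z; q)` vanishes: neither `z` nor `x z` is an integral
power of `q`. -/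
def AppellDefined (x z q : ℂ) : Prop :=
  (∀ n : ℤ, z ≠ q ^ n) ∧ (∀ n : ℤ, x * z ≠ q ^ n)

/-- `Θ_{n,m}(z; q) = ∑_{a ∈ ℤ + n / (2m)} q ^ (m a²) z ^ (-m a)`, where `z = exp (2 π i u)` and
`q = exp (2 π i τ)`. -/
def thetaSW (n m : ℤ) (u τ : ℂ) : ℂ :=
  ∑' k : ℤ, epow τ (m * ((k : ℂ) + n / (2 * m)) ^ 2) * epow u (-(m * ((k : ℂ) + n / (2 * m))))

/-- The admissible level `N = p' / p - 2`. -/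
def admLevel (p p' : ℕ) : ℂ := (p' : ℂ) / p - 2

/-- The admissible `A₁⁽¹⁾` character `χ_ℓ^{(p,p')}(z; q)` of spin `ℓ`, in Weyl-Kac form, where
`z = exp (2 π i u)` and `q = exp (2 π i τ)`, so that `q ^ p = exp (2 π i p τ)`. -/
def admChar (p p' ℓ : ℕ) (u τ : ℂ) : ℂ :=
  (thetaSW (ℓ + 1) p' u (p * τ) - thetaSW (-(ℓ + 1)) p' u (p * τ)) /
    (thetaSW 1 2 u τ - thetaSW (-1) 2 u τ)

/-- The string function `C_{m,ℓ}^{(p,p')}(q)`, for `m ≡ ℓ` modulo 2: `C_{m,ℓ} q ^ (m² / (4N))` is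
the coefficient of `z ^ (-m / 2)` in the Laurent expansion of `χ_ℓ^{(p,p')}(z; q)` in the annulus
`|q| < |z| < |q|⁻¹`, computed on the unit circle `z = exp (2 π i x)`, `0 ≤ x ≤ 1`. The
singularity of the quotient at `z = 1` is removable. -/
def stringFn (p p' : ℕ) (m : ℤ) (ℓ : ℕ) (τ : ℂ) : ℂ :=
  epow τ (-((m : ℂ) ^ 2 / (4 * admLevel p p'))) *
    ∫ x in (0 : ℝ)..1, admChar p p' ℓ (x : ℂ) τ * epow (x : ℂ) ((m : ℂ) / 2)

end

/-!
The character is a quotient of theta functions in `z`, hence quasi-periodic under `z ↦ z q ^ (2p)`,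
with the automorphy factor of a theta function of level `j`, and it has at most simple poles, at
`z = q ^ n` for `n` not divisible by `p` (`admChar_add_two_mul`, `tendsto_sub_mul_admChar`).

For (i), the numerator also vanishes at `z = 1`, so that the character extends to a holomorphic
function of `u` in the strip `|im u| < im τ`. A (anti)periodic holomorphic function in a strip is
the sum of its Fourier series (`hasSum_fourier_strip`), and its coefficients are the string
functions by definition (`hasSum_admChar`).

For (ii), the geometric sum `∑_{s < j} w ^ s / (1 - w ^ j) = 1 / (1 - w)` collapses the double sum
over `s` and over the Appell series into the sums
`S_M(z) = ∑_n q ^ (j p n² + p n) z ^ (-j n) / (1 - q ^ (p (2 n - 1) + M) z⁻¹)` with `0 < |M| < p`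
(`polarPart_eq`). Each `S_M` has the same quasi-periodicity as the character, up to the factor
`z ^ (1 / 2)`, and modulo this quasi-periodicity its only pole is `z = q ^ (p + M)`. The residues
there agree with those of the character (`residue_eq_sub`, `residue_eq_add`), because the
combination of theta functions in the polar part is the value of the numerator at `z = q ^ (p - m)`
(`numTheta_sub_mul`), while the derivative of the denominator is a power of `q` times `(q)_∞ ^ 3`
(`hasDerivAt_denTheta`). So the character minus its polar part is entire in `u` and
quasi-periodic, and its Laurent coefficients satisfy a recurrence of step `j`, so that it is a
combination of `j` theta functions weighted by the coefficients at `z ^ (-s - 1 / 2)`, `0 ≤ s < j`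
(`eq_sum_theta_of_quasiPeriodic`). The expansion of `S_M` around the unit circle contains no power
`z ^ (-s)` with `0 ≤ s < j` (`integral_appellSum_mul_ee`), so these weights are the string
functions.

The theta functions `jTheta`, given as products, and the Weyl–Kac theta series are both expressed
through Mathlib's `jacobiTheta₂`. The bridge is the Jacobi triple product identity
(`jTheta_eq_jacobiTheta₂`), obtained from the `q`-binomial theorem by dominated convergence.
-/

noncomputable section

open Filter Topology

/-! ### The exponential `exp (2 π i x)` -/

/-- The exponential `x ↦ exp (2 π i x)`. Every (fractional) power `q ^ a` or `z ^ a` in the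
theorem is a value of it. -/
def ee (x : ℂ) : ℂ := Complex.exp (2 * Real.pi * Complex.I * x)

lemma epow_eq_ee (t a : ℂ) : epow t a = ee (a * t) := by
  simp only [epow, ee]; ring_nf

lemma ee_add (x y : ℂ) : ee (x + y) = ee x * ee y := by
  simp only [ee, mul_add, Complex.exp_add]

lemma ee_zero : ee 0 = 1 := by simp [ee]

lemma ee_ne_zero (x : ℂ) : ee x ≠ 0 := Complex.exp_ne_zero _

lemma ee_neg (x : ℂ) : ee (-x) = (ee x)⁻¹ := by
  simp only [ee, mul_neg, Complex.exp_neg]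

lemma ee_sub (x y : ℂ) : ee (x - y) = ee x / ee y := by
  rw [sub_eq_add_neg, ee_add, ee_neg, div_eq_mul_inv]

lemma ee_eq_one_iff (x : ℂ) : ee x = 1 ↔ ∃ n : ℤ, x = n := by
  have h : (2 * Real.pi * Complex.I : ℂ) ≠ 0 := Complex.two_pi_I_ne_zero
  rw [ee, Complex.exp_eq_one_iff]
  refine exists_congr fun n => ⟨fun e => ?_, fun e => by rw [e]; ring⟩
  exact mul_left_cancel₀ h (e.trans (mul_comm _ _))

lemma ee_int (n : ℤ) : ee n = 1 := (ee_eq_one_iff _).2 ⟨n, rfl⟩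

lemma ee_one : ee 1 = 1 := by simpa using ee_int 1

lemma ee_half : ee (1 / 2) = -1 := by
  rw [ee, show (2 * Real.pi * Complex.I * (1 / 2) : ℂ) = Real.pi * Complex.I by ring,
    Complex.exp_pi_mul_I]

lemma ee_add_int (x : ℂ) (n : ℤ) : ee (x + n) = ee x := by rw [ee_add, ee_int, mul_one]

lemma ee_pow (x : ℂ) (n : ℕ) : ee x ^ n = ee (n * x) := by
  rw [ee, ← Complex.exp_nat_mul, ee]; ring_nf

lemma ee_zpow (x : ℂ) (n : ℤ) : ee x ^ n = ee (n * x) := by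
  rw [ee, ← Complex.exp_int_mul, ee]; ring_nf

lemma neg_ee (x : ℂ) : -ee x = ee (x + 1 / 2) := by rw [ee_add, ee_half]; ring

lemma norm_ee (x : ℂ) : ‖ee x‖ = Real.exp (-(2 * Real.pi * x.im)) := by
  rw [ee, Complex.norm_exp]; simp

lemma norm_ee_lt_one {x : ℂ} (h : 0 < x.im) : ‖ee x‖ < 1 := by
  rw [norm_ee, Real.exp_lt_one_iff]
  have := Real.pi_pos
  nlinarith [mul_pos this h]

lemma hasDerivAt_ee (x : ℂ) : HasDerivAt ee (2 * Real.pi * Complex.I * ee x) x := by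
  have h := ((hasDerivAt_id x).const_mul (2 * Real.pi * Complex.I : ℂ)).cexp
  have e : ee = fun x => cexp (2 * Real.pi * Complex.I * id x) := rfl
  rw [e]
  exact h.congr_deriv (by simp only [id]; ring)

@[fun_prop]
lemma differentiable_ee : Differentiable ℂ ee := fun x => (hasDerivAt_ee x).differentiableAt

@[fun_prop]
lemma continuous_ee : Continuous ee := differentiable_ee.continuous

/-! ### The Jacobi triple product -/

/-- The finite product `(q; q)_n`. -/
def qFact (q : ℂ) (n : ℕ) : ℂ := ∏ i ∈ range n, (1 - q ^ (i + 1))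

/-- The Gaussian binomial coefficient, defined by one of its Pascal recursions. -/
def qBinom (q : ℂ) : ℕ → ℕ → ℂ
  | _, 0 => 1
  | 0, _ + 1 => 0
  | N + 1, k + 1 => q ^ (k + 1) * qBinom q N (k + 1) + qBinom q N k

lemma qBinom_zero_right (q : ℂ) (N : ℕ) : qBinom q N 0 = 1 := by cases N <;> simp [qBinom]

lemma qBinom_eq_zero (q : ℂ) {N k : ℕ} (h : N < k) : qBinom q N k = 0 := by
  induction N generalizing k with
  | zero => obtain ⟨k, rfl⟩ := Nat.exists_eq_succ_of_ne_zero h.ne'; simp [qBinom]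
  | succ N ih =>
    obtain ⟨k, rfl⟩ := Nat.exists_eq_succ_of_ne_zero (Nat.ne_zero_of_lt h)
    simp only [qBinom]
    rw [ih (by omega), ih (by omega)]; simp

lemma qBinom_self (q : ℂ) (N : ℕ) : qBinom q N N = 1 := by
  induction N with
  | zero => simp [qBinom]
  | succ N ih => simp [qBinom, ih, qBinom_eq_zero q (Nat.lt_succ_self N)]

lemma qFact_succ (q : ℂ) (n : ℕ) : qFact q (n + 1) = qFact q n * (1 - q ^ (n + 1)) := by
  simp [qFact, prod_range_succ]

/-- The closed form `(q)_{a+b} / ((q)_a (q)_b)` of the Gaussian binomial coefficient. -/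
lemma qBinom_mul_qFact (q : ℂ) (a b : ℕ) :
    qBinom q (a + b) a * qFact q a * qFact q b = qFact q (a + b) := by
  induction a generalizing b with
  | zero => simp [qBinom_zero_right, qFact]
  | succ a iha =>
    induction b with
    | zero => simp [qBinom_self, qFact]
    | succ b ihb =>
      have h1 := iha (b + 1)
      have h2 := ihb
      have e : a + 1 + (b + 1) = (a + (b + 1)) + 1 := by ring
      rw [e, qBinom, qFact_succ q (a + (b + 1))]
      have e2 : a + 1 + b = a + (b + 1) := by ring
      rw [e2] at h2
      rw [qFact_succ q b] at *
      rw [qFact_succ q a] at *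
      have e3 : q ^ (a + (b + 1) + 1) = q ^ (a + 1) * q ^ (b + 1) := by ring
      rw [e3]
      linear_combination (1 - q ^ (a + 1)) * h1 + q ^ (a + 1) * (1 - q ^ (b + 1)) * h2

/-- The `q`-binomial theorem. -/
lemma prod_one_add_pow_mul (q : ℂ) (N : ℕ) (y : ℂ) :
    ∏ i ∈ range N, (1 + q ^ i * y) =
      ∑ k ∈ range (N + 1), q ^ (k.choose 2) * qBinom q N k * y ^ k := by
  induction N generalizing y with
  | zero => simp [qBinom]
  | succ N ih =>
    have hch : ∀ k : ℕ, (k + 1).choose 2 = k + k.choose 2 := fun k => by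
      rw [Nat.choose_succ_succ' k 1]; simp
    rw [prod_range_succ', pow_zero, one_mul]
    have h := ih (q * y)
    have h' : ∏ i ∈ range N, (1 + q ^ (i + 1) * y) = ∏ i ∈ range N, (1 + q ^ i * (q * y)) :=
      prod_congr rfl fun i _ => by ring
    rw [h', h, sum_range_succ' _ (N + 1), mul_add, mul_one]
    have hA : ∑ k ∈ range (N + 1), q ^ (k.choose 2) * qBinom q N k * (q * y) ^ k =
        ∑ k ∈ range (N + 1), q ^ ((k + 1).choose 2) * (q ^ (k + 1) * qBinom q N (k + 1)) *
          y ^ (k + 1) + 1 := by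
      have : ∑ k ∈ range (N + 1), q ^ (k.choose 2) * qBinom q N k * (q * y) ^ k =
          ∑ k ∈ range (N + 2), q ^ (k.choose 2) * qBinom q N k * (q * y) ^ k := by
        rw [sum_range_succ _ (N + 1), qBinom_eq_zero q (Nat.lt_succ_self N)]; simp
      rw [this, sum_range_succ' _ (N + 1)]
      congr 1
      · exact sum_congr rfl fun k _ => by rw [mul_pow]; ring
      · simp [qBinom_zero_right]
    have hB : (∑ k ∈ range (N + 1), q ^ (k.choose 2) * qBinom q N k * (q * y) ^ k) * y =
        ∑ k ∈ range (N + 1), q ^ ((k + 1).choose 2) * qBinom q N k * y ^ (k + 1) := by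
      rw [sum_mul]
      exact sum_congr rfl fun k _ => by rw [hch, mul_pow, pow_add]; ring
    rw [hB, hA]
    simp only [qBinom, mul_add, add_mul, sum_add_distrib, Nat.choose_zero_succ,
      pow_zero, mul_one]
    ring

/-- The `n`-th partial product of the triple product, as a finite theta series. -/
lemma prod_theta_partial (t v : ℂ) (n : ℕ) :
    ∏ i ∈ range n, ((1 - ee t ^ i * ee v) * (1 - ee t ^ i * (ee t / ee v))) =
      ∑ k ∈ range (2 * n + 1),
        jacobiTheta₂_term ((k : ℤ) - n) (v - t / 2 + 1 / 2) t * qBinom (ee t) (2 * n) k := by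
  -- the `q`-binomial theorem at `y = -x q ^ (-n)`, which centres the product
  have hq := prod_one_add_pow_mul (ee t) (2 * n) (ee (v + 1 / 2 - n * t))
  have hterm : ∀ k : ℕ, ee t ^ (k.choose 2) * qBinom (ee t) (2 * n) k *
      ee (v + 1 / 2 - n * t) ^ k = ee (n * (v + 1 / 2) - n * (n + 1) / 2 * t) *
        (jacobiTheta₂_term ((k : ℤ) - n) (v - t / 2 + 1 / 2) t * qBinom (ee t) (2 * n) k) := by
    intro k
    have : ee t ^ (k.choose 2) * ee (v + 1 / 2 - n * t) ^ k =
        ee (n * (v + 1 / 2) - n * (n + 1) / 2 * t) *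
          jacobiTheta₂_term ((k : ℤ) - n) (v - t / 2 + 1 / 2) t := by
      rw [ee_pow, ee_pow, Nat.cast_choose_two]
      simp only [ee, jacobiTheta₂_term, ← Complex.exp_add]
      congr 1; push_cast; ring
    linear_combination qBinom (ee t) (2 * n) k * this
  rw [sum_congr rfl fun k _ => hterm k, ← mul_sum] at hq
  refine mul_left_cancel₀ (ee_ne_zero (n * (v + 1 / 2) - n * (n + 1) / 2 * t)) ?_
  rw [← hq, two_mul, prod_range_add, prod_mul_distrib, mul_left_comm, mul_comm]
  congr 1
  · have h1 : ee (n * (v + 1 / 2) - n * (n + 1) / 2 * t) =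
        ∏ i ∈ range n, ee (v + 1 / 2 - (i + 1) * t) := by
      clear hq hterm
      induction n with
      | zero => simp [ee_zero]
      | succ n ih =>
        rw [prod_range_succ, ← ih, ← ee_add]; congr 1; push_cast; ring
    rw [h1, ← prod_mul_distrib, ← prod_range_reflect]
    refine prod_congr rfl fun i hi => ?_
    have hi' : i < n := mem_range.1 hi
    have hc : ((n - 1 - i : ℕ) : ℂ) = n - 1 - i := by
      rw [Nat.cast_sub (by omega), Nat.cast_sub (by omega)]; simp
    have e1 : v + 1 / 2 - ((n - 1 - i : ℂ) + 1) * t = i * t + (v + 1 / 2 - n * t) := by ring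
    have e2 : v + 1 / 2 - ((n - 1 - i : ℂ) + 1) * t + ((n - 1 - i : ℂ) * t + (t - v)) = 1 / 2 := by
      ring
    rw [ee_pow, hc, ← ee_sub, ← ee_add, mul_sub, mul_one, ← ee_add, e2, ee_half, e1, ee_add,
      ee_pow]
    ring
  · refine prod_congr rfl fun i _ => ?_
    rw [ee_pow, ee_pow, ← ee_add, ← ee_add, sub_eq_add_neg, neg_ee]
    congr 2; push_cast; ring

lemma qPochInf_eq (x q : ℂ) : qPochInf x q = ∏' i : ℕ, (1 + -(q ^ i * x)) := by
  simp only [qPochInf, sub_eq_add_neg]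

lemma summable_norm_neg_pow_mul {q : ℂ} (hq : ‖q‖ < 1) (x : ℂ) :
    Summable fun i : ℕ => ‖-(q ^ i * x)‖ := by
  simp only [norm_neg, norm_mul, norm_pow]
  exact (summable_geometric_of_lt_one (norm_nonneg _) hq).mul_right _

lemma hasProd_qPochInf {q : ℂ} (hq : ‖q‖ < 1) (x : ℂ) :
    HasProd (fun i : ℕ => 1 - q ^ i * x) (qPochInf x q) := by
  have h := (multipliable_one_add_of_summable (summable_norm_neg_pow_mul hq x)).hasProd
  rw [← qPochInf_eq] at h
  simpa only [sub_eq_add_neg] using h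

lemma qPochInf_ne_zero {q : ℂ} (hq : ‖q‖ < 1) {x : ℂ} (h : ∀ i : ℕ, q ^ i * x ≠ 1) :
    qPochInf x q ≠ 0 := by
  rw [qPochInf_eq]
  refine tprod_one_add_ne_zero_of_summable (fun i => ?_) (summable_norm_neg_pow_mul hq x)
  rw [← sub_eq_add_neg]
  exact sub_ne_zero.2 (h i).symm

lemma qPochInf_self_ne_zero {q : ℂ} (hq : ‖q‖ < 1) : qPochInf q q ≠ 0 := by
  refine qPochInf_ne_zero hq fun i h => ?_
  have h' := congrArg norm h
  rw [← pow_succ, norm_pow, norm_one] at h'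
  exact absurd h' (pow_lt_one₀ (norm_nonneg _) hq (Nat.succ_ne_zero i)).ne

lemma tendsto_qFact {q : ℂ} (hq : ‖q‖ < 1) :
    Tendsto (qFact q) atTop (𝓝 (qPochInf q q)) := by
  have h := (hasProd_qPochInf hq q).tendsto_prod_nat
  refine h.congr fun n => prod_congr rfl fun i _ => by rw [pow_succ]

lemma qFact_ne_zero {q : ℂ} (hq : ‖q‖ < 1) (n : ℕ) : qFact q n ≠ 0 := by
  refine prod_ne_zero_iff.2 fun i _ => sub_ne_zero.2 fun h => ?_
  have h' := congrArg norm h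
  rw [norm_pow, norm_one] at h'
  exact absurd h'.symm (pow_lt_one₀ (norm_nonneg _) hq (Nat.succ_ne_zero i)).ne

lemma continuous_qPochInf {q : ℂ} (hq : ‖q‖ < 1) : Continuous fun x => qPochInf x q := by
  refine continuous_iff_continuousAt.2 fun x => ?_
  simp only [qPochInf_eq, ContinuousAt]
  refine tendsto_tprod_one_add_of_dominated_convergence (bound := fun i => ‖q‖ ^ i * (‖x‖ + 1))
    ((summable_geometric_of_lt_one (norm_nonneg _) hq).mul_right _) (fun i => ?_) ?_
  · exact ((continuous_const.mul continuous_id).neg).continuousAt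
  · filter_upwards [Metric.ball_mem_nhds x one_pos] with y hy i
    rw [norm_neg, norm_mul, norm_pow]
    gcongr
    have := norm_sub_norm_le y x
    rw [Metric.mem_ball, dist_eq_norm] at hy
    linarith

/-- The coefficient of the `l`-th theta term in the `n`-th partial product of the triple
product. -/
def tripleCoeff (q : ℂ) (n : ℕ) (l : ℤ) : ℂ :=
  if 0 ≤ l + n then qBinom q (2 * n) (l + n).toNat else 0

lemma tripleCoeff_eq {q : ℂ} (hq : ‖q‖ < 1) {n : ℕ} {l : ℤ} (h : l.natAbs ≤ n) :
    tripleCoeff q n l =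
      qFact q (2 * n) / (qFact q (l + n).toNat * qFact q (n - l).toNat) := by
  rw [tripleCoeff, if_pos (by omega), eq_div_iff (mul_ne_zero (qFact_ne_zero hq _)
    (qFact_ne_zero hq _)), ← mul_assoc]
  have := qBinom_mul_qFact q (l + n).toNat (n - l).toNat
  rwa [show (l + n).toNat + (n - l).toNat = 2 * n by omega] at this

lemma tripleCoeff_eq_zero (q : ℂ) {n : ℕ} {l : ℤ} (h : n < l.natAbs) : tripleCoeff q n l = 0 := by
  rw [tripleCoeff]
  split_ifs with h'
  · exact qBinom_eq_zero q (by omega)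
  · rfl

lemma tendsto_tripleCoeff {q : ℂ} (hq : ‖q‖ < 1) (l : ℤ) :
    Tendsto (fun n => tripleCoeff q n l) atTop (𝓝 (qPochInf q q)⁻¹) := by
  have hL := qPochInf_self_ne_zero hq
  have h1 : Tendsto (fun n : ℕ => 2 * n) atTop atTop :=
    tendsto_atTop_atTop.2 fun b => ⟨b, fun a ha => by omega⟩
  have h2 : Tendsto (fun n : ℕ => (l + n).toNat) atTop atTop :=
    tendsto_atTop_atTop.2 fun b => ⟨b + l.natAbs, fun a ha => by omega⟩
  have h3 : Tendsto (fun n : ℕ => ((n : ℤ) - l).toNat) atTop atTop :=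
    tendsto_atTop_atTop.2 fun b => ⟨b + l.natAbs, fun a ha => by omega⟩
  have hF := tendsto_qFact hq
  have h := (hF.comp h1).div ((hF.comp h2).mul (hF.comp h3)) (mul_ne_zero hL hL)
  have e : qPochInf q q / (qPochInf q q * qPochInf q q) = (qPochInf q q)⁻¹ := by
    field_simp
  rw [e] at h
  refine h.congr' ?_
  filter_upwards [eventually_ge_atTop l.natAbs] with n hn
  rw [tripleCoeff_eq hq hn]
  rfl

lemma exists_norm_tripleCoeff_le {q : ℂ} (hq : ‖q‖ < 1) :
    ∃ C : ℝ, ∀ n l, ‖tripleCoeff q n l‖ ≤ C := by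
  obtain ⟨A, hA⟩ := (Metric.isBounded_range_of_tendsto _ (tendsto_qFact hq)).exists_norm_le
  obtain ⟨B, hB⟩ := (Metric.isBounded_range_of_tendsto _
    ((tendsto_qFact hq).inv₀ (qPochInf_self_ne_zero hq))).exists_norm_le
  have hA' : ∀ n, ‖qFact q n‖ ≤ A := fun n => hA _ ⟨n, rfl⟩
  have hB' : ∀ n, ‖(qFact q n)⁻¹‖ ≤ B := fun n => hB _ ⟨n, rfl⟩
  have hA0 : 0 ≤ A := (norm_nonneg _).trans (hA' 0)
  have hB0 : 0 ≤ B := (norm_nonneg _).trans (hB' 0)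
  refine ⟨A * (B * B), fun n l => ?_⟩
  rcases le_or_gt l.natAbs n with h | h
  · rw [tripleCoeff_eq hq h, div_eq_mul_inv, mul_inv, norm_mul, norm_mul]
    gcongr
    exacts [hA' _, hB' _, hB' _]
  · rw [tripleCoeff_eq_zero q h, norm_zero]; positivity

lemma tsum_tripleCoeff (t v : ℂ) (n : ℕ) :
    ∑' l : ℤ, jacobiTheta₂_term l (v - t / 2 + 1 / 2) t * tripleCoeff (ee t) n l =
      ∏ i ∈ range n, ((1 - ee t ^ i * ee v) * (1 - ee t ^ i * (ee t / ee v))) := by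
  rw [prod_theta_partial]
  have hinj : Function.Injective fun k : ℕ => (k : ℤ) - n := fun a b h => by
    simpa using h
  rw [← hinj.tsum_eq, tsum_eq_sum (s := range (2 * n + 1))]
  · refine sum_congr rfl fun k _ => ?_
    rw [tripleCoeff, if_pos (by omega)]
    congr 2
    omega
  · intro k hk
    rw [tripleCoeff_eq_zero, mul_zero]
    rw [mem_range] at hk
    omega
  · intro l hl
    have h0 : 0 ≤ l + n := by
      by_contra hneg
      refine hl ?_
      simp only [tripleCoeff, if_neg hneg, mul_zero]
    exact ⟨(l + n).toNat, by simp only; omega⟩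

/-- The **Jacobi triple product identity**. -/
theorem jTheta_eq_jacobiTheta₂ {t : ℂ} (ht : 0 < t.im) (v : ℂ) :
    jTheta (ee v) (ee t) = jacobiTheta₂ (v - t / 2 + 1 / 2) t := by
  have hq := norm_ee_lt_one ht
  obtain ⟨C, hC⟩ := exists_norm_tripleCoeff_le hq
  have hs : Summable fun l : ℤ => ‖jacobiTheta₂_term l (v - t / 2 + 1 / 2) t‖ :=
    ((summable_jacobiTheta₂_term_iff _ t).2 ht).norm
  -- both sides are the limit of the partial products
  have h1 : Tendsto (fun n => ∑' l : ℤ, jacobiTheta₂_term l (v - t / 2 + 1 / 2) t *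
      tripleCoeff (ee t) n l) atTop (𝓝 (∑' l : ℤ, jacobiTheta₂_term l (v - t / 2 + 1 / 2) t *
        (qPochInf (ee t) (ee t))⁻¹)) := by
    refine tendsto_tsum_of_dominated_convergence
      (bound := fun l => ‖jacobiTheta₂_term l (v - t / 2 + 1 / 2) t‖ * C) (hs.mul_right C)
      (fun l => (tendsto_tripleCoeff hq l).const_mul _) (Eventually.of_forall fun n l => ?_)
    rw [norm_mul]
    gcongr
    exact hC n l
  have h2 := ((hasProd_qPochInf hq (ee v)).mul
    (hasProd_qPochInf hq (ee t / ee v))).tendsto_prod_nat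
  simp only [tsum_tripleCoeff] at h1
  have h := tendsto_nhds_unique h1 h2
  rw [tsum_mul_right] at h
  rw [jTheta, ← h, mul_assoc, inv_mul_cancel₀ (qPochInf_self_ne_zero hq), mul_one]
  rfl

lemma jTheta_neg_eq_jacobiTheta₂ {t : ℂ} (ht : 0 < t.im) (v : ℂ) :
    jTheta (-ee v) (ee t) = jacobiTheta₂ (v - t / 2) t := by
  rw [neg_ee, jTheta_eq_jacobiTheta₂ ht, ← jacobiTheta₂_add_left (v - t / 2)]
  congr 1; ring

lemma jTheta_ne_zero {t : ℂ} (ht : 0 < t.im) {v : ℂ} (h : ∀ n : ℤ, ee v ≠ ee t ^ n) :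
    jTheta (ee v) (ee t) ≠ 0 := by
  have hq := norm_ee_lt_one ht
  refine mul_ne_zero (mul_ne_zero (qPochInf_ne_zero hq fun i hi => h (-i) ?_)
    (qPochInf_ne_zero hq fun i hi => h (i + 1) ?_)) (qPochInf_self_ne_zero hq)
  · rw [zpow_neg, zpow_natCast]
    exact eq_inv_of_mul_eq_one_right hi
  · rw [mul_div_assoc', div_eq_one_iff_eq (ee_ne_zero _)] at hi
    rw [← hi]
    exact_mod_cast (pow_succ (ee t) i).symm

lemma qPochInf_eq_mul {q : ℂ} (hq : ‖q‖ < 1) (x : ℂ) :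
    qPochInf x q = (1 - x) * qPochInf (q * x) q := by
  have e : (fun i : ℕ => 1 - q ^ (i + 1) * x) = fun i => 1 - q ^ i * (q * x) :=
    funext fun i => by ring
  have h : Multipliable fun i : ℕ => 1 - q ^ (i + 1) * x := by
    rw [e]; exact (hasProd_qPochInf hq (q * x)).multipliable
  have key : ∏' i : ℕ, (1 - q ^ i * x) = (1 - q ^ 0 * x) * ∏' i : ℕ, (1 - q ^ (i + 1) * x) :=
    tprod_eq_zero_mul' (f := fun i : ℕ => 1 - q ^ i * x) h
  rw [e, pow_zero, one_mul] at key
  exact key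

/-- The simple zero of the theta function at `x = 1`: its derivative is that of the factor `1 - x`
times the remaining product. -/
lemma hasDerivAt_jTheta_ee {t : ℂ} (ht : 0 < t.im) :
    HasDerivAt (fun v => jTheta (ee v) (ee t))
      (-(2 * Real.pi * Complex.I) * qPochInf (ee t) (ee t) ^ 3) 0 := by
  have hq := norm_ee_lt_one ht
  have hc := continuous_qPochInf hq
  have hee : Continuous ee := continuous_ee
  have hg : ContinuousAt (fun v => qPochInf (ee t * ee v) (ee t) *
      qPochInf (ee t / ee v) (ee t) * qPochInf (ee t) (ee t)) 0 := by
    refine Continuous.continuousAt ?_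
    exact ((hc.comp (continuous_const.mul hee)).mul
      (hc.comp (continuous_const.div hee ee_ne_zero))).mul continuous_const
  have h1 : HasDerivAt (fun v => 1 - ee v) (-(2 * Real.pi * Complex.I)) 0 := by
    simpa [ee_zero] using (hasDerivAt_ee 0).const_sub 1
  have hf : (fun v => jTheta (ee v) (ee t)) = fun v => (1 - ee v) *
      (qPochInf (ee t * ee v) (ee t) * qPochInf (ee t / ee v) (ee t) * qPochInf (ee t) (ee t)) :=
    funext fun v => by rw [jTheta, qPochInf_eq_mul hq]; ring
  rw [hf, hasDerivAt_iff_tendsto_slope] at *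
  have h2 := h1.mul (hg.tendsto.mono_left nhdsWithin_le_nhds)
  simp only [ee_zero, mul_one, div_one] at h2
  rw [show -(2 * Real.pi * Complex.I) * qPochInf (ee t) (ee t) ^ 3 = -(2 * Real.pi * Complex.I) *
    (qPochInf (ee t) (ee t) * qPochInf (ee t) (ee t) * qPochInf (ee t) (ee t)) by ring]
  refine h2.congr fun v => ?_
  simp only [slope_def_field, ee_zero, sub_self, zero_mul]
  ring

/-! ### Theta functions -/

/-- A sum over `ℤ` split into the residue classes modulo `j`. -/
lemma tsum_eq_sum_tsum_mul_add {f : ℤ → ℂ} (hf : Summable f) {j : ℕ} (hj : 1 ≤ j) :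
    ∑' k, f k = ∑ s ∈ range j, ∑' n : ℤ, f (n * j + s) := by
  have : NeZero j := ⟨by omega⟩
  rw [← (Int.divModEquiv j).symm.tsum_eq]
  have hs : Summable (f ∘ (Int.divModEquiv j).symm) := (Int.divModEquiv j).symm.summable_iff.2 hf
  rw [Finset.sum_range (fun s => ∑' n : ℤ, f (n * j + s)),
    ← (Equiv.prodComm (Fin j) ℤ).tsum_eq]
  exact hs.prod_symm.tsum_prod.trans (tsum_fintype _)

lemma jacobiTheta₂_eq_tsum (v t : ℂ) : jacobiTheta₂ v t = ∑' n : ℤ, ee (n * v + n ^ 2 * t / 2) :=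
  tsum_congr fun n => by rw [jacobiTheta₂_term, ee]; ring_nf

lemma summable_ee_theta (v : ℂ) {t : ℂ} (ht : 0 < t.im) :
    Summable fun n : ℤ => ee (n * v + n ^ 2 * t / 2) :=
  ((summable_jacobiTheta₂_term_iff v t).2 ht).congr fun n => by
    rw [jacobiTheta₂_term, ee]; ring_nf

lemma jacobiTheta₂_add_int (v t : ℂ) (n : ℤ) : jacobiTheta₂ (v + n) t = jacobiTheta₂ v t := by
  simp only [jacobiTheta₂_eq_tsum]
  refine tsum_congr fun k => ?_
  rw [show k * (v + n) + k ^ 2 * t / 2 = k * v + k ^ 2 * t / 2 + ((k * n : ℤ) : ℂ) by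
    push_cast; ring, ee_add_int]

lemma jacobiTheta₂_add_int_mul (v t : ℂ) (n : ℤ) :
    jacobiTheta₂ (v + n * t) t = ee (-(n ^ 2 * t / 2) - n * v) * jacobiTheta₂ v t := by
  simp only [jacobiTheta₂_eq_tsum]
  rw [← tsum_mul_left, ← (Equiv.addRight n).tsum_eq (fun k : ℤ => ee _ * ee _)]
  refine tsum_congr fun k => ?_
  rw [← ee_add, Equiv.coe_addRight]
  congr 1; push_cast; ring

lemma jacobiTheta₂_eq_even_add_odd (v : ℂ) {t : ℂ} (ht : 0 < t.im) :
    jacobiTheta₂ v t =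
      jacobiTheta₂ (2 * v) (4 * t) + ee (v + t / 2) * jacobiTheta₂ (2 * v + 2 * t) (4 * t) := by
  rw [jacobiTheta₂_eq_tsum, tsum_eq_sum_tsum_mul_add (summable_ee_theta v ht) one_le_two,
    show range 2 = {0, 1} from rfl, sum_pair zero_ne_one]
  simp only [jacobiTheta₂_eq_tsum, ← tsum_mul_left, ← ee_add]
  congr 1 <;> refine tsum_congr fun n => congrArg ee ?_ <;> push_cast <;> ring

lemma thetaSW_eq (n m : ℤ) (hm : m ≠ 0) (u t : ℂ) :
    thetaSW n m u t = ee (n ^ 2 * t / (4 * m) - n * u / 2) *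
      jacobiTheta₂ (n * t - m * u) (2 * m * t) := by
  have hm' : (m : ℂ) ≠ 0 := Int.cast_ne_zero.2 hm
  rw [thetaSW, jacobiTheta₂_eq_tsum, ← tsum_mul_left]
  refine tsum_congr fun k => ?_
  rw [epow_eq_ee, epow_eq_ee, ← ee_add, ← ee_add]
  congr 1; field_simp; ring

/-! ### The denominator of the character -/

/-- The Weyl–Kac denominator `Θ_{1,2} - Θ_{-1,2}`. -/
def denTheta (τ u : ℂ) : ℂ := thetaSW 1 2 u τ - thetaSW (-1) 2 u τ

lemma denTheta_eq_jTheta {τ : ℂ} (hτ : 0 < τ.im) (u : ℂ) :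
    denTheta τ u = ee (τ / 8 - u / 2) * jTheta (ee u) (ee τ) := by
  rw [denTheta, thetaSW_eq 1 2 two_ne_zero, thetaSW_eq (-1) 2 two_ne_zero,
    jTheta_eq_jacobiTheta₂ hτ, jacobiTheta₂_eq_even_add_odd _ hτ, mul_add, ← mul_assoc, ← ee_add,
    sub_eq_add_neg, ← neg_mul, neg_ee]
  have e1 : jacobiTheta₂ (2 * (u - τ / 2 + 1 / 2)) (4 * τ) = jacobiTheta₂ (τ - 2 * u) (4 * τ) := by
    rw [← jacobiTheta₂_neg_left (τ - 2 * u), ← jacobiTheta₂_add_left (-(τ - 2 * u))]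
    congr 1; ring
  have e2 : jacobiTheta₂ (2 * (u - τ / 2 + 1 / 2) + 2 * τ) (4 * τ) =
      jacobiTheta₂ (-τ - 2 * u) (4 * τ) := by
    rw [← jacobiTheta₂_neg_left (-τ - 2 * u), ← jacobiTheta₂_add_left (-(-τ - 2 * u))]
    congr 1; ring
  rw [e1, e2]
  push_cast
  congr 2
  · congr 1; ring
  · ring_nf
  · congr 1; ring
  · ring_nf

lemma denTheta_eq_jacobiTheta₂ {τ : ℂ} (hτ : 0 < τ.im) (u : ℂ) :
    denTheta τ u = ee (τ / 8 - u / 2) * jacobiTheta₂ (u - τ / 2 + 1 / 2) τ := by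
  rw [denTheta_eq_jTheta hτ, jTheta_eq_jacobiTheta₂ hτ]

lemma differentiable_jacobiTheta₂_fst {t : ℂ} (ht : 0 < t.im) :
    Differentiable ℂ fun v => jacobiTheta₂ v t := fun v => differentiableAt_jacobiTheta₂_fst v ht

lemma differentiable_denTheta {τ : ℂ} (hτ : 0 < τ.im) : Differentiable ℂ (denTheta τ) := by
  rw [show denTheta τ = _ from funext (denTheta_eq_jacobiTheta₂ hτ)]
  refine Differentiable.mul (differentiable_ee.comp (by fun_prop))
    ((differentiable_jacobiTheta₂_fst hτ).comp (by fun_prop))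

lemma denTheta_add_one {τ : ℂ} (hτ : 0 < τ.im) (u : ℂ) :
    denTheta τ (u + 1) = -denTheta τ u := by
  rw [denTheta_eq_jTheta hτ, denTheta_eq_jTheta hτ, ee_add u, ee_one, mul_one, ← neg_mul, neg_ee,
    ← ee_add_int (τ / 8 - (u + 1) / 2) 1]
  congr 2; push_cast; ring

lemma denTheta_add_int_mul {τ : ℂ} (hτ : 0 < τ.im) (u : ℂ) (n : ℤ) :
    denTheta τ (u + n * τ) = ee (n / 2 - n ^ 2 * τ / 2 - n * u) * denTheta τ u := by
  rw [denTheta_eq_jacobiTheta₂ hτ, denTheta_eq_jacobiTheta₂ hτ,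
    show u + n * τ - τ / 2 + 1 / 2 = (u - τ / 2 + 1 / 2) + n * τ by ring,
    jacobiTheta₂_add_int_mul, ← mul_assoc, ← mul_assoc, ← ee_add, ← ee_add]
  congr 1
  rw [← ee_add_int _ n]
  congr 1; ring

lemma denTheta_ne_zero {τ : ℂ} (hτ : 0 < τ.im) {u : ℂ} (h : ∀ n : ℤ, ee u ≠ ee τ ^ n) :
    denTheta τ u ≠ 0 := by
  rw [denTheta_eq_jTheta hτ]
  exact mul_ne_zero (ee_ne_zero _) (jTheta_ne_zero hτ h)

lemma denTheta_zero {τ : ℂ} : denTheta τ 0 = 0 := by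
  rw [denTheta, thetaSW_eq 1 2 two_ne_zero, thetaSW_eq (-1) 2 two_ne_zero, sub_eq_zero]
  have : jacobiTheta₂ ((-1 : ℤ) * τ - (2 : ℤ) * 0) (2 * (2 : ℤ) * τ) =
      jacobiTheta₂ ((1 : ℤ) * τ - (2 : ℤ) * 0) (2 * (2 : ℤ) * τ) := by
    rw [← jacobiTheta₂_neg_left]; congr 1; push_cast; ring
  rw [this]; congr 2; push_cast; ring

lemma hasDerivAt_denTheta_zero {τ : ℂ} (hτ : 0 < τ.im) :
    HasDerivAt (denTheta τ)
      (-(2 * Real.pi * Complex.I) * ee (τ / 8) * qPochInf (ee τ) (ee τ) ^ 3) 0 := by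
  have h0 : jTheta (ee 0) (ee τ) = 0 := by
    have := denTheta_eq_jTheta hτ 0
    rw [denTheta_zero] at this
    exact (mul_eq_zero.1 this.symm).resolve_left (ee_ne_zero _)
  have h1 : DifferentiableAt ℂ (fun u : ℂ => ee (τ / 8 - u / 2)) 0 :=
    (differentiable_ee _).comp _ (by fun_prop)
  have h := h1.hasDerivAt.mul (hasDerivAt_jTheta_ee hτ)
  rw [h0, mul_zero, zero_add] at h
  rw [show denTheta τ = _ from funext (denTheta_eq_jTheta hτ)]
  refine h.congr_deriv ?_
  simp only [zero_div, sub_zero]; ring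

lemma denTheta_int_mul {τ : ℂ} (hτ : 0 < τ.im) (n : ℤ) : denTheta τ (n * τ) = 0 := by
  have := denTheta_add_int_mul hτ 0 n
  rwa [zero_add, denTheta_zero, mul_zero] at this

lemma hasDerivAt_denTheta {τ : ℂ} (hτ : 0 < τ.im) (n : ℤ) :
    HasDerivAt (denTheta τ) (-(2 * Real.pi * Complex.I) * ee (τ / 8 + n / 2 - n ^ 2 * τ / 2) *
      qPochInf (ee τ) (ee τ) ^ 3) (n * τ) := by
  have h0 := hasDerivAt_denTheta_zero hτ
  rw [← sub_self (n * τ)] at h0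
  have hid : HasDerivAt (fun u : ℂ => id u - n * τ) 1 (n * τ) := (hasDerivAt_id _).sub_const _
  have h2 := HasDerivAt.comp (n * τ) (h := fun u : ℂ => id u - n * τ) h0 hid
  have h1 : DifferentiableAt ℂ (fun u : ℂ => ee (n / 2 - n ^ 2 * τ / 2 - n * (u - n * τ)))
      (n * τ) := (differentiable_ee _).comp _ (by fun_prop)
  have h := h1.hasDerivAt.mul h2
  have e : denTheta τ = fun u => ee (n / 2 - n ^ 2 * τ / 2 - n * (u - n * τ)) *
      (denTheta τ ∘ fun u => id u - n * τ) u := funext fun u => by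
    rw [Function.comp, id, ← denTheta_add_int_mul hτ, sub_add_cancel]
  rw [e]
  refine h.congr_deriv ?_
  simp only [Function.comp, id, sub_self, denTheta_zero, mul_zero, zero_add, sub_zero, mul_one]
  rw [show τ / 8 + n / 2 - n ^ 2 * τ / 2 = τ / 8 + (n / 2 - n ^ 2 * τ / 2) by ring, ee_add]
  ring

/-! ### The numerator of the character -/

/-- One of the two theta functions in the numerator of the character, up to a constant; the other
one is its value at `-u`. -/
def numHalf (p p' r : ℕ) (τ u : ℂ) : ℂ :=
  ee (-((r + 1) * u)) * jacobiTheta₂ (2 * (r + 1) * p * τ - p' * u) (2 * p * p' * τ)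

/-- The Weyl–Kac numerator of the character of spin `2r + 1`. -/
def numTheta (p p' r : ℕ) (τ u : ℂ) : ℂ :=
  ee (p * (r + 1) ^ 2 * τ / p') * (numHalf p p' r τ u - numHalf p p' r τ (-u))

lemma admChar_eq_div {p p' r : ℕ} (hp' : 1 ≤ p') (u τ : ℂ) :
    admChar p p' (2 * r + 1) u τ = numTheta p p' r τ u / denTheta τ u := by
  have h0 : (p' : ℤ) ≠ 0 := by omega
  have h0' : (p' : ℂ) ≠ 0 := by exact_mod_cast h0
  rw [admChar, denTheta, thetaSW_eq _ _ h0, thetaSW_eq _ _ h0, numTheta, numHalf, numHalf]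
  simp only [mul_sub (ee _), ← mul_assoc (ee _) (ee _), ← ee_add]
  congr 2
  · congr 1
    · congr 1; push_cast; field_simp; ring
    · congr 1 <;> push_cast <;> ring
  · congr 1
    · congr 1; push_cast; field_simp; ring
    · rw [← jacobiTheta₂_neg_left]; congr 1 <;> push_cast <;> ring

section numerator

variable {p p' r : ℕ} {τ : ℂ}

lemma im_nat_mul_pos {n : ℕ} (hn : 1 ≤ n) (hτ : 0 < τ.im) : 0 < ((n : ℂ) * τ).im := by
  have : (0 : ℝ) < n := by exact_mod_cast hn
  simpa using mul_pos this hτ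

lemma differentiable_numTheta (hp : 1 ≤ p) (hp' : 1 ≤ p') (hτ : 0 < τ.im) :
    Differentiable ℂ (numTheta p p' r τ) := by
  have him : 0 < (2 * p * p' * τ).im := by
    simpa using im_nat_mul_pos (n := 2 * p * p') (by nlinarith) hτ
  have hA : Differentiable ℂ (numHalf p p' r τ) :=
    Differentiable.mul (differentiable_ee.comp (by fun_prop))
      ((differentiable_jacobiTheta₂_fst him).comp (by fun_prop))
  exact (hA.sub (hA.comp differentiable_neg)).const_mul _

lemma numTheta_neg (u : ℂ) : numTheta p p' r τ (-u) = -numTheta p p' r τ u := by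
  rw [numTheta, numTheta, neg_neg]; ring

lemma numTheta_zero : numTheta p p' r τ 0 = 0 := by simp [numTheta]

lemma numHalf_add_one (u : ℂ) : numHalf p p' r τ (u + 1) = numHalf p p' r τ u := by
  rw [numHalf, numHalf, ← jacobiTheta₂_add_int _ _ (p' : ℤ), ← ee_add_int _ (r + 1)]
  congr 2 <;> push_cast <;> ring

lemma numTheta_add_one (u : ℂ) : numTheta p p' r τ (u + 1) = numTheta p p' r τ u := by
  have h := numHalf_add_one (p := p) (p' := p') (r := r) (τ := τ) (-(u + 1))
  rw [show -(u + 1) + 1 = -u by ring] at h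
  rw [numTheta, numTheta, numHalf_add_one, h]

lemma numHalf_add_two_mul (u : ℂ) : numHalf p p' r τ (u + 2 * p * τ) =
    ee (-(p * p' * τ) - p' * u) * numHalf p p' r τ u := by
  rw [numHalf, numHalf, show 2 * (r + 1) * p * τ - p' * (u + 2 * p * τ) =
    (2 * (r + 1) * p * τ - p' * u) + (-1 : ℤ) * (2 * p * p' * τ) by push_cast; ring,
    jacobiTheta₂_add_int_mul]
  simp only [← mul_assoc (ee _) (ee _), ← ee_add]
  congr 2; push_cast; ring

lemma numTheta_add_two_mul (u : ℂ) : numTheta p p' r τ (u + 2 * p * τ) =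
    ee (-(p * p' * τ) - p' * u) * numTheta p p' r τ u := by
  have h := numHalf_add_two_mul (p := p) (p' := p') (r := r) (τ := τ) (-(u + 2 * p * τ))
  rw [show -(u + 2 * p * τ) + 2 * p * τ = -u by ring] at h
  have h' : numHalf p p' r τ (-(u + 2 * p * τ)) =
      ee (-(p * p' * τ) - p' * u) * numHalf p p' r τ (-u) := by
    rw [h, ← mul_assoc, ← ee_add]
    rw [show -(p * p' * τ) - p' * u + (-(p * p' * τ) - p' * -(u + 2 * p * τ)) = 0 by ring,
      ee_zero, one_mul]
  rw [numTheta, numTheta, numHalf_add_two_mul, h']; ring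

lemma numTheta_mul_self : numTheta p p' r τ (p * τ) = 0 := by
  have h := numTheta_add_two_mul (p := p) (p' := p') (r := r) (τ := τ) (-(p * τ))
  rw [show -(p * τ) + 2 * p * τ = p * τ by ring, numTheta_neg,
    show -(p * p' * τ) - p' * -(p * τ) = 0 by ring, ee_zero, one_mul] at h
  exact self_eq_neg.1 h

/-- The combination of two theta functions attached to `m` in the polar part, up to a power of
`q` the value of the numerator at `z = q ^ (p - m)`. -/
def polarTheta (p p' r : ℕ) (τ m : ℂ) : ℂ :=
  jacobiTheta₂ (m * p' * τ + 2 * p * (r + 1) * τ - p * p' * τ) (2 * p * p' * τ) -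
    ee ((m * p' - 2 * m * (r + 1)) * τ) *
      jacobiTheta₂ (-(m * p' * τ) + 2 * p * (r + 1) * τ - p * p' * τ) (2 * p * p' * τ)

lemma numTheta_sub_mul (m : ℂ) : numTheta p p' r τ ((p - m) * τ) =
    ee ((p * (r + 1) ^ 2 / p' - (p - m) * (r + 1)) * τ) * polarTheta p p' r τ m := by
  have e2 : jacobiTheta₂ (2 * (r + 1) * p * τ - p' * -((p - m) * τ)) (2 * p * p' * τ) =
      ee (-(p * p' * τ) - (-(m * p' * τ) + 2 * p * (r + 1) * τ - p * p' * τ)) *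
      jacobiTheta₂ (-(m * p' * τ) + 2 * p * (r + 1) * τ - p * p' * τ) (2 * p * p' * τ) := by
    rw [show 2 * (r + 1) * p * τ - p' * -((p - m) * τ) =
      (-(m * p' * τ) + 2 * p * (r + 1) * τ - p * p' * τ) + (1 : ℤ) * (2 * p * p' * τ) by
        push_cast; ring, jacobiTheta₂_add_int_mul]
    congr 2; push_cast; ring
  rw [numTheta, numHalf, numHalf, e2, polarTheta]
  simp only [mul_sub (ee _), ← mul_assoc (ee _) (ee _), ← ee_add]
  congr 2
  · congr 1; ring
  · congr 1; ring
  · congr 1; ring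

lemma numTheta_add_mul (m : ℂ) : numTheta p p' r τ ((p + m) * τ) =
    -(ee (-(m * p' * τ)) * numTheta p p' r τ ((p - m) * τ)) := by
  rw [show (p + m) * τ = -((p - m) * τ) + 2 * p * τ by ring, numTheta_add_two_mul, numTheta_neg,
    mul_neg]
  congr 3; ring

end numerator

lemma admChar_add_one {p p' r : ℕ} (hp' : 1 ≤ p') {τ : ℂ} (hτ : 0 < τ.im) (u : ℂ) :
    admChar p p' (2 * r + 1) (u + 1) τ = -admChar p p' (2 * r + 1) u τ := by
  rw [admChar_eq_div hp', admChar_eq_div hp', numTheta_add_one, denTheta_add_one hτ, div_neg]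

lemma admChar_add_two_mul {p j r : ℕ} (hp : 1 ≤ p) {τ : ℂ} (hτ : 0 < τ.im) (u : ℂ) :
    admChar p (2 * p + j) (2 * r + 1) (u + 2 * p * τ) τ =
      ee (-(p * j * τ) - j * u) * admChar p (2 * p + j) (2 * r + 1) u τ := by
  have h := denTheta_add_int_mul hτ u (2 * p)
  push_cast at h
  rw [admChar_eq_div (by omega), admChar_eq_div (by omega), numTheta_add_two_mul, h,
    mul_div_mul_comm, ← ee_sub, ← ee_add_int _ p]
  congr 2; push_cast; ring

/-! ### Fourier expansions of periodic holomorphic functions -/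

lemma hasSum_integral_of_norm_le {ι : Type*} [Countable ι] {F : ι → ℝ → ℂ} {f : ℝ → ℂ} {b : ι → ℝ}
    (hF : ∀ i, Continuous (F i)) (hb : Summable b) (hle : ∀ i x, ‖F i x‖ ≤ b i)
    (hs : ∀ x, HasSum (fun i => F i x) (f x)) :
    HasSum (fun i => ∫ x in (0 : ℝ)..1, F i x) (∫ x in (0 : ℝ)..1, f x) :=
  intervalIntegral.hasSum_integral_of_dominated_convergence (fun i _ => b i)
    (fun i => (hF i).aestronglyMeasurable) (fun i => .of_forall fun x _ => hle i x)
    (.of_forall fun _ _ => hb) (by simp) (.of_forall fun x _ => hs x)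

lemma integral_ee_mul (m : ℤ) :
    ∫ x in (0 : ℝ)..1, ee (m * x) = if m = 0 then 1 else 0 := by
  split_ifs with h
  · simp [h, ee_zero]
  · have hm : (2 * Real.pi * Complex.I * m : ℂ) ≠ 0 :=
      mul_ne_zero Complex.two_pi_I_ne_zero (Int.cast_ne_zero.2 h)
    have := integral_exp_mul_complex (a := 0) (b := 1) hm
    have e : ∀ x : ℝ, ee (m * x) = cexp (2 * Real.pi * Complex.I * m * x) := fun x => by
      rw [ee, mul_assoc _ (m : ℂ)]
    have e1 : cexp (2 * Real.pi * Complex.I * m * (1 : ℝ)) = 1 := by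
      rw [← e 1]; simpa using ee_int m
    have e0 : cexp (2 * Real.pi * Complex.I * m * (0 : ℝ)) = 1 := by
      rw [← e 0]; simp [ee_zero]
    simp only [e]
    rw [this, e1, e0, sub_self, zero_div]

/-- The coefficients of an absolutely convergent Fourier series are the Fourier coefficients of its
sum. -/
lemma fourier_coeff_unique {c : ℤ → ℂ} {g : ℝ → ℂ}
    (hc : ∀ x : ℝ, HasSum (fun k : ℤ => c k * ee (k * x)) (g x)) (k : ℤ) :
    c k = ∫ x in (0 : ℝ)..1, g x * ee (-(k * x)) := by
  have hn : ∀ (n : ℤ) (x : ℝ), ‖ee (n * x)‖ = 1 := fun n x => by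
    rw [norm_ee]; simp
  have hs : Summable fun n : ℤ => ‖c n‖ := by
    have := (hc 0).summable.norm
    simpa [ee_zero] using this
  have h := hasSum_integral_of_norm_le (F := fun (n : ℤ) x => c n * ee (n * x) * ee (-(k * x)))
    (f := fun x => g x * ee (-(k * x))) (fun n => by fun_prop) hs
    (fun n x => by
      rw [norm_mul, norm_mul, hn, ee_neg, norm_inv, hn]; simp)
    (fun x => (hc x).mul_right _)
  have e : ∀ n : ℤ, ∫ x in (0 : ℝ)..1, c n * ee (n * x) * ee (-(k * x)) =
      if n = k then c k else 0 := fun n => by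
    have e1 : ∀ x : ℝ, c n * ee (n * x) * ee (-(k * x)) = c n * ee ((n - k : ℤ) * x) := fun x => by
      rw [mul_assoc, ← ee_add]; congr 2; push_cast; ring
    simp only [e1]
    rw [intervalIntegral.integral_const_mul, integral_ee_mul]
    by_cases hnk : n = k
    · simp [hnk]
    · simp [hnk, sub_eq_zero]
  simp only [e] at h
  exact (hasSum_ite_eq k (c k)).unique h

section strip

variable {T : ℝ} {h : ℂ → ℂ}

/-- The Fourier coefficients of a periodic holomorphic function may be computed at any height. -/
lemma integral_strip_eq (hd : DifferentiableOn ℂ h {u | |u.im| < T})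
    (hper : ∀ u : ℂ, |u.im| < T → h (u + 1) = h u) (k : ℤ) {y : ℝ} (hy : |y| < T) :
    ∫ x in (0 : ℝ)..1, h (x + y * I) * ee (-(k * (x + y * I))) =
      ∫ x in (0 : ℝ)..1, h x * ee (-(k * x)) := by
  set f : ℂ → ℂ := fun u => h u * ee (-(k * u)) with hf
  have hT : 0 < T := (abs_nonneg y).trans_lt hy
  have hfd : DifferentiableOn ℂ f {u | |u.im| < T} :=
    hd.mul ((differentiable_ee.comp (by fun_prop)).differentiableOn)
  have hfp : ∀ u : ℂ, |u.im| < T → f (u + 1) = f u := fun u hu => by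
    simp only [hf]
    rw [hper u hu, show -(k * (u + 1)) = -(k * u) + ((-k : ℤ) : ℂ) by push_cast; ring, ee_add_int]
  have key := Complex.integral_boundary_rect_eq_zero_of_differentiableOn f 0 (1 + y * I)
    (hfd.mono fun u hu => by
      have h2 := (Complex.mem_reProdIm.1 hu).2
      simp only [Complex.add_im, Complex.one_im, Complex.mul_im, Complex.ofReal_re, Complex.I_im,
        mul_one, Complex.ofReal_im, Complex.I_re, mul_zero, add_zero, zero_add,
        Complex.zero_im] at h2
      have h3 := Set.mem_uIcc.1 h2
      rw [abs_lt] at hy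
      rw [Set.mem_ofPred_eq, abs_lt]
      rcases h3 with h3 | h3 <;> constructor <;> linarith [h3.1, h3.2])
  simp only [Complex.zero_re, Complex.add_re, Complex.one_re, Complex.mul_re, Complex.ofReal_re,
    Complex.I_re, mul_zero, Complex.ofReal_im, Complex.I_im, mul_one, sub_self, add_zero,
    Complex.zero_im, Complex.ofReal_zero, zero_mul, Complex.add_im, Complex.one_im, Complex.mul_im,
    zero_add, Complex.ofReal_one] at key
  -- the vertical sides cancel by periodicity
  have hside : ∫ t in (0 : ℝ)..y, f (1 + t * I) = ∫ t in (0 : ℝ)..y, f (t * I) := by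
    refine intervalIntegral.integral_congr fun t ht => ?_
    have h3 := Set.mem_uIcc.1 ht
    rw [add_comm, hfp]
    simp only [Complex.mul_im, Complex.ofReal_re, Complex.I_im, mul_one, Complex.ofReal_im,
      Complex.I_re, mul_zero, add_zero]
    rw [abs_lt] at hy ⊢
    rcases h3 with h3 | h3 <;> constructor <;> linarith [h3.1, h3.2]
  rw [hside, add_sub_cancel_right, sub_eq_zero] at key
  exact key.symm

lemma exists_norm_coeff_le (hd : DifferentiableOn ℂ h {u | |u.im| < T})
    (hper : ∀ u : ℂ, |u.im| < T → h (u + 1) = h u) {y : ℝ} (hy : |y| < T) :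
    ∃ B : ℝ, ∀ k : ℤ, ‖∫ x in (0 : ℝ)..1, h x * ee (-(k * x))‖ ≤
      B * Real.exp (2 * Real.pi * k * y) := by
  have hc : ContinuousOn (fun x : ℝ => h (x + y * I)) (Set.Icc 0 1) :=
    hd.continuousOn.comp (by fun_prop) fun x _ => by simpa using hy
  obtain ⟨B, hB⟩ := isCompact_Icc.exists_bound_of_continuousOn hc
  refine ⟨B, fun k => ?_⟩
  rw [← integral_strip_eq hd hper k hy]
  have := intervalIntegral.norm_integral_le_of_norm_le_const (a := 0) (b := 1)
    (f := fun x : ℝ => h (x + y * I) * ee (-(k * (x + y * I))))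
    (C := B * Real.exp (2 * Real.pi * k * y)) (fun x hx => by
      rw [Set.uIoc_of_le zero_le_one] at hx
      rw [norm_mul, norm_ee]
      have e : -(2 * Real.pi * (-(k * (x + y * I)) : ℂ).im) = 2 * Real.pi * k * y := by
        simp; ring
      rw [e]
      gcongr
      exact hB x ⟨hx.1.le, hx.2⟩)
  simpa using this

/-- The Fourier (Laurent) expansion of a `1`-periodic function holomorphic in a horizontal
strip. -/
theorem hasSum_fourier_strip (hd : DifferentiableOn ℂ h {u | |u.im| < T})
    (hper : ∀ u : ℂ, |u.im| < T → h (u + 1) = h u) {u : ℂ} (hu : |u.im| < T) :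
    HasSum (fun k : ℤ => (∫ x in (0 : ℝ)..1, h x * ee (-(k * x))) * ee (k * u)) (h u) := by
  set c : ℤ → ℂ := fun k => ∫ x in (0 : ℝ)..1, h x * ee (-(k * x)) with hcdef
  set v := u.im with hv
  -- evaluating the coefficients at the heights `v ± δ` gives exponential decay
  obtain ⟨δ, hδ, hδ1, hδ2⟩ : ∃ δ : ℝ, 0 < δ ∧ |v - δ| < T ∧ |v + δ| < T := by
    refine ⟨(T - |v|) / 2, by linarith, ?_, ?_⟩ <;> rw [abs_lt] <;> constructor <;>
      linarith [le_abs_self v, neg_abs_le v]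
  obtain ⟨B₁, hB₁⟩ := exists_norm_coeff_le hd hper hδ1
  obtain ⟨B₂, hB₂⟩ := exists_norm_coeff_le hd hper hδ2
  have hnorm : ∀ (k : ℤ) (w : ℂ), w.im = v → ‖ee (k * w)‖ = Real.exp (-(2 * Real.pi * (k * v))) :=
    fun k w hw => by rw [norm_ee]; simp [hw]
  have hsum : Summable fun k : ℤ => c k * ee (k * (v * I)) := by
    have hgeo : Summable fun n : ℕ => Real.exp (-(2 * Real.pi * δ)) ^ n := by
      refine summable_geometric_of_lt_one (Real.exp_pos _).le ?_
      rw [Real.exp_lt_one_iff]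
      have := mul_pos Real.pi_pos hδ
      linarith
    refine Summable.of_nat_of_neg ?_ ?_
    · refine Summable.of_norm_bounded (hgeo.mul_left B₁) fun n => ?_
      rw [norm_mul, hnorm _ _ (by simp)]
      refine (mul_le_mul_of_nonneg_right (hB₁ n) (Real.exp_pos _).le).trans_eq ?_
      rw [mul_assoc, ← Real.exp_add, ← Real.exp_nat_mul]
      congr 2; push_cast; ring
    · refine Summable.of_norm_bounded (hgeo.mul_left B₂) fun n => ?_
      rw [norm_mul, hnorm _ _ (by simp)]
      refine (mul_le_mul_of_nonneg_right (hB₂ _) (Real.exp_pos _).le).trans_eq ?_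
      rw [mul_assoc, ← Real.exp_add, ← Real.exp_nat_mul]
      congr 2; push_cast; ring
  have hline : Function.Periodic (fun x : ℝ => h (x + v * I)) 1 := fun x => by
    have := hper (x + v * I) (by simpa using hu)
    simp only
    rw [← this]; congr 1; push_cast; ring
  have hcont : Continuous fun x : ℝ => h (x + v * I) :=
    hd.continuousOn.comp_continuous (by fun_prop) fun x => by simpa using hu
  let f : C(AddCircle (1 : ℝ), ℂ) := ⟨hline.lift, by
    exact continuous_coinduced_dom.2 hcont⟩
  have hf : ∀ x : ℝ, f (x : AddCircle (1 : ℝ)) = h (x + v * I) := fun x => hline.lift_coe x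
  have hcoef : ∀ k : ℤ, fourierCoeff f k = c k * ee (k * (v * I)) := fun k => by
    rw [fourierCoeff_eq_intervalIntegral _ _ 0, hcdef]
    simp only
    rw [← integral_strip_eq hd hper k hu, ← intervalIntegral.integral_mul_const]
    simp only [zero_add, one_div, inv_one, one_smul]
    refine intervalIntegral.integral_congr fun x _ => ?_
    simp only [hf, fourier_coe_apply, smul_eq_mul]
    rw [mul_assoc (h _), ← ee_add, mul_comm]
    congr 1
    rw [ee]
    congr 1
    push_cast; ring
  have := has_pointwise_sum_fourier_series_of_summable (f := f)
    (hsum.congr fun k => (hcoef k).symm) (u.re : AddCircle (1 : ℝ))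
  rw [hf, hv, Complex.re_add_im] at this
  convert this using 2 with k
  rw [hcoef, smul_eq_mul, fourier_coe_apply, mul_assoc]
  congr 1
  conv_lhs => rw [← Complex.re_add_im u, mul_add, add_comm, ee_add]
  rw [← hv]
  congr 1
  rw [ee]
  congr 1
  push_cast; ring

end strip

/-! ### Removable singularities and quasi-periods -/

/-- Riemann's removable singularity theorem, with the extension given by `limUnder` at every
point. -/
lemma differentiableAt_limUnder {f : ℂ → ℂ} {c : ℂ}
    (hd : ∀ᶠ z in 𝓝[≠] c, DifferentiableAt ℂ f z)
    (ho : Tendsto (fun z => (z - c) * f z) (𝓝[≠] c) (𝓝 0)) :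
    DifferentiableAt ℂ (fun z => limUnder (𝓝[≠] z) f) c := by
  have hd' : ∀ᶠ z in 𝓝 c, z ≠ c → DifferentiableAt ℂ f z := eventually_nhdsWithin_iff.1 hd
  obtain ⟨s, hs, hsd⟩ := eventually_iff_exists_mem.1 hd'
  have hlit : (fun z => f z - f c) =o[𝓝[≠] c] fun z => (z - c)⁻¹ := by
    refine (Asymptotics.isLittleO_iff_tendsto' ?_).2 ?_
    · filter_upwards [self_mem_nhdsWithin] with z hz h
      exact absurd (inv_eq_zero.1 h) (sub_ne_zero.2 hz)
    · have h1 : Tendsto (fun z => (z - c) * f c) (𝓝[≠] c) (𝓝 0) := by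
        have : Continuous fun z : ℂ => (z - c) * f c := by fun_prop
        have h2 := this.tendsto c
        simp only [sub_self, zero_mul] at h2
        exact h2.mono_left nhdsWithin_le_nhds
      have h3 := ho.sub h1
      rw [sub_zero] at h3
      refine h3.congr fun z => ?_
      rw [div_inv_eq_mul]; ring
  have h := Complex.differentiableOn_update_limUnder_of_isLittleO hs
    (fun z hz => (hsd z hz.1 hz.2).differentiableWithinAt) hlit
  refine (h.differentiableAt hs).congr_of_eventuallyEq ?_
  filter_upwards [hd'] with z hz
  by_cases hzc : z = c
  · rw [hzc, Function.update_self]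
  · rw [Function.update_of_ne hzc]
    exact ((hz hzc).continuousAt.tendsto.mono_left nhdsWithin_le_nhds).limUnder_eq

lemma limUnder_eq_of_continuousAt {f : ℂ → ℂ} {c : ℂ} (h : ContinuousAt f c) :
    limUnder (𝓝[≠] c) f = f c :=
  (h.tendsto.mono_left nhdsWithin_le_nhds).limUnder_eq

/-- `ω` is a quasi-period of `F`: translation by `ω` multiplies `F` by a continuous nowhere
vanishing function. -/
def IsQuasiPeriod (F : ℂ → ℂ) (ω : ℂ) : Prop :=
  ∃ g : ℂ → ℂ, Continuous g ∧ (∀ u, g u ≠ 0) ∧ ∀ u, F (u + ω) = g u * F u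

namespace IsQuasiPeriod

variable {F : ℂ → ℂ} {ω ω' : ℂ}

lemma zero : IsQuasiPeriod F 0 := ⟨fun _ => 1, continuous_const, fun _ => one_ne_zero, by simp⟩

lemma add (h : IsQuasiPeriod F ω) (h' : IsQuasiPeriod F ω') : IsQuasiPeriod F (ω + ω') := by
  obtain ⟨g, hg, hg0, hgF⟩ := h
  obtain ⟨g', hg', hg0', hgF'⟩ := h'
  refine ⟨fun u => g' (u + ω) * g u, by fun_prop, fun u => mul_ne_zero (hg0' _) (hg0 _),
    fun u => ?_⟩
  rw [← add_assoc, hgF', hgF, mul_assoc]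

lemma neg (h : IsQuasiPeriod F ω) : IsQuasiPeriod F (-ω) := by
  obtain ⟨g, hg, hg0, hgF⟩ := h
  refine ⟨fun u => (g (u + -ω))⁻¹, ?_, fun u => inv_ne_zero (hg0 _), fun u => ?_⟩
  · exact (hg.comp (continuous_add_const _)).inv₀ fun u => hg0 _
  · rw [eq_inv_mul_iff_mul_eq₀ (hg0 _), ← hgF, neg_add_cancel_right]

lemma int_mul (h : IsQuasiPeriod F ω) (n : ℤ) : IsQuasiPeriod F (n * ω) := by
  induction n with
  | zero => simpa using zero
  | succ n ih => rw [Int.cast_add, Int.cast_one, add_mul, one_mul]; exact ih.add h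
  | pred n ih =>
    rw [Int.cast_sub, Int.cast_one, sub_mul, one_mul, sub_eq_add_neg]; exact ih.add h.neg

lemma tendsto_sub_mul (h : IsQuasiPeriod F ω) {c : ℂ}
    (hF : Tendsto (fun u => (u - c) * F u) (𝓝[≠] c) (𝓝 0)) :
    Tendsto (fun u => (u - (c + ω)) * F u) (𝓝[≠] (c + ω)) (𝓝 0) := by
  obtain ⟨g, hg, -, hgF⟩ := h
  have ht : Tendsto (fun u => u - ω) (𝓝[≠] (c + ω)) (𝓝[≠] c) := by
    refine tendsto_nhdsWithin_iff.2 ⟨?_, ?_⟩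
    · have : Continuous fun u : ℂ => u - ω := by fun_prop
      have h2 := this.tendsto (c + ω)
      simp only [add_sub_cancel_right] at h2
      exact h2.mono_left nhdsWithin_le_nhds
    · filter_upwards [self_mem_nhdsWithin] with u hu h
      exact hu (by rw [← h]; simp)
  have h1 := ((hg.tendsto c).mono_left nhdsWithin_le_nhds).mul hF
  rw [mul_zero] at h1
  refine (h1.comp ht).congr fun u => ?_
  have := hgF (u - ω)
  rw [sub_add_cancel] at this
  simp only [Function.comp, this]; ring

end IsQuasiPeriod

/-! ### Appell–Lerch sums -/

/-- A lower bound for `|1 - w|` in terms of the distance of `|w|` from `1`. -/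
lemma le_norm_one_sub_ee {a : ℝ} {x : ℂ} (h : a ≤ |x.im|) :
    1 - Real.exp (-(2 * Real.pi * a)) ≤ ‖1 - ee x‖ := by
  have hpi := Real.pi_pos
  rcases le_abs.1 h with h | h
  · have h1 := norm_sub_norm_le 1 (ee x)
    rw [norm_one, norm_ee] at h1
    have h2 : Real.exp (-(2 * Real.pi * x.im)) ≤ Real.exp (-(2 * Real.pi * a)) := by
      rw [Real.exp_le_exp]; nlinarith
    linarith
  · have h1 := norm_sub_norm_le (ee x) 1
    rw [norm_one, norm_ee, norm_sub_rev] at h1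
    have h2 : Real.exp (2 * Real.pi * a) ≤ Real.exp (-(2 * Real.pi * x.im)) := by
      rw [Real.exp_le_exp]; nlinarith
    have h3 := Real.add_one_le_exp (2 * Real.pi * a)
    have h4 := Real.add_one_le_exp (-(2 * Real.pi * a))
    linarith

lemma one_sub_exp_pos {a : ℝ} (h : 0 < a) : 0 < 1 - Real.exp (-(2 * Real.pi * a)) := by
  rw [sub_pos, Real.exp_lt_one_iff]
  have := mul_pos Real.pi_pos h
  linarith

/-- If `g` has a simple zero at `c`, then `(u - c) / g u` tends to `1 / g' c`. -/
lemma tendsto_sub_div {g : ℂ → ℂ} {g' c : ℂ} (hg : HasDerivAt g g' c) (hc : g c = 0)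
    (hg' : g' ≠ 0) : Tendsto (fun u => (u - c) / g u) (𝓝[≠] c) (𝓝 g'⁻¹) := by
  refine ((hasDerivAt_iff_tendsto_slope.1 hg).inv₀ hg').congr fun u => ?_
  rw [slope_def_field, hc, sub_zero, inv_div]

lemma tendsto_sub_mul_of_continuousAt {g : ℂ → ℂ} {c : ℂ} (hg : ContinuousAt g c) :
    Tendsto (fun u => (u - c) * g u) (𝓝[≠] c) (𝓝 0) := by
  have h1 : ContinuousAt (fun u => (u - c) * g u) c := by fun_prop
  have h2 := h1.tendsto
  simp only [sub_self, zero_mul] at h2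
  exact h2.mono_left nhdsWithin_le_nhds

/-- For `|ρ| < 1` the expansion of `1 / (1 - ρ z)` on the unit circle has no negative powers of
`z`. -/
lemma integral_ee_div_one_sub_eq_zero {a : ℂ} (ha : 0 < a.im) {k : ℕ} (hk : 1 ≤ k) :
    ∫ x in (0 : ℝ)..1, ee (k * x) / (1 - ee (a + x)) = 0 := by
  have hsum : ∀ x : ℝ, HasSum (fun n : ℤ => (if 0 ≤ n then ee (n * a) else 0) * ee (n * x))
      (1 - ee (a + x))⁻¹ := fun x => by
    rw [← Nat.cast_injective.hasSum_iff (f := fun n : ℤ =>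
      (if 0 ≤ n then ee (n * a) else 0) * ee (n * x))]
    · have h := hasSum_geometric_of_norm_lt_one (norm_ee_lt_one (x := a + x) (by simpa using ha))
      have e : (fun n : ℕ => ee (a + x) ^ n) = (fun n : ℤ =>
          (if 0 ≤ n then ee (n * a) else 0) * ee (n * x)) ∘ Nat.cast := funext fun n => by
        rw [Function.comp, if_pos (Int.natCast_nonneg n), ← ee_add, ee_pow]
        congr 1; push_cast; ring
      rw [e] at h
      exact h
    · intro n hn
      have : ¬ 0 ≤ n := fun h0 => hn ⟨n.toNat, Int.toNat_of_nonneg h0⟩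
      simp only [if_neg this, zero_mul]
  have h := fourier_coeff_unique hsum (-k)
  rw [if_neg (by omega)] at h
  rw [h]
  refine intervalIntegral.integral_congr fun x _ => ?_
  rw [div_eq_inv_mul]
  congr 2; push_cast; ring

lemma integral_ee_neg_div_one_sub_eq_zero {a : ℂ} (ha : 0 < a.im) {k : ℕ} (hk : 1 ≤ k) :
    ∫ x in (0 : ℝ)..1, ee (-(k * x)) / (1 - ee (a - x)) = 0 := by
  rw [← integral_ee_div_one_sub_eq_zero ha hk]
  have h := intervalIntegral.integral_comp_sub_left (a := 0) (b := 1)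
    (fun x : ℝ => ee (-(k * x)) / (1 - ee (a - x))) 1
  rw [sub_self, sub_zero] at h
  rw [← h]
  refine intervalIntegral.integral_congr fun x _ => ?_
  congr 1
  · rw [← ee_add_int (k * x) (-k)]; congr 1; push_cast; ring
  · rw [← ee_add_int (a + x) (-1)]; congr 2; push_cast; ring

/-- The summand of `appellSum`. -/
def appellTerm (p j : ℕ) (M : ℤ) (τ u : ℂ) (n : ℤ) : ℂ :=
  ee ((j * p * n ^ 2 + n * p) * τ - j * n * u) / (1 - ee ((p * (2 * n - 1) + M) * τ - u))

/-- The level `j` Appell–Lerch sum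
`∑_n q ^ (j p n² + p n) z ^ (-j n) / (1 - q ^ (p (2 n - 1) + M) z⁻¹)`. Up to quasi-periodicity its
only pole is the simple pole at `z = q ^ (p + M)`. -/
def appellSum (p j : ℕ) (M : ℤ) (τ u : ℂ) : ℂ := ∑' n : ℤ, appellTerm p j M τ u n

section appell

variable {p j : ℕ} {τ : ℂ}

/-- A Gaussian majorant for the numerators of `appellTerm` when `|im u| ≤ R`. -/
def appellBound (p j : ℕ) (τ : ℂ) (R : ℝ) (n : ℤ) : ℝ :=
  Real.exp (-Real.pi * ((2 * j * p * τ.im) * n ^ 2 - 2 * (p * τ.im + j * R) * |n|))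

lemma summable_appellBound (hp : 1 ≤ p) (hj : 1 ≤ j) (hτ : 0 < τ.im) (R : ℝ) :
    Summable (appellBound p j τ R) := by
  have h : 0 < 2 * j * p * τ.im := by
    have h1 : (0 : ℝ) < p := by exact_mod_cast hp
    have h2 : (0 : ℝ) < j := by exact_mod_cast hj
    positivity
  exact (summable_pow_mul_jacobiTheta₂_term_bound (p * τ.im + j * R) h 0).congr fun n => by
    rw [pow_zero, one_mul, appellBound, Int.cast_abs]

lemma appellBound_nonneg (R : ℝ) (n : ℤ) : 0 ≤ appellBound p j τ R n := (Real.exp_pos _).le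

lemma norm_appell_num_le (hτ : 0 < τ.im) {R : ℝ} {u : ℂ} (hu : |u.im| ≤ R) (n : ℤ) :
    ‖ee ((j * p * n ^ 2 + n * p) * τ - j * n * u)‖ ≤ appellBound p j τ R n := by
  rw [norm_ee, appellBound, Real.exp_le_exp]
  have e : ((j * p * n ^ 2 + n * p) * τ - j * n * u : ℂ).im =
      (j * p * n ^ 2 + n * p) * τ.im - j * n * u.im := by
    have h1 : (j * p * n ^ 2 + n * p : ℂ) = ((j * p * n ^ 2 + n * p : ℝ) : ℂ) := by push_cast; ring
    have h2 : (j * n : ℂ) = ((j * n : ℝ) : ℂ) := by push_cast; ring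
    rw [h1, h2, Complex.sub_im, Complex.im_ofReal_mul, Complex.im_ofReal_mul]
  rw [e]
  have h1 : -(n : ℝ) ≤ |(n : ℝ)| := neg_le_abs _
  have h2 : (n : ℝ) * u.im ≤ |(n : ℝ)| * R := by
    refine (le_abs_self _).trans ?_
    rw [abs_mul]; gcongr
  have h3 : -(n : ℝ) * (p * τ.im) ≤ |(n : ℝ)| * (p * τ.im) := by gcongr
  have h4 : (j : ℝ) * (n * u.im) ≤ j * (|(n : ℝ)| * R) := by gcongr
  have hpi := Real.pi_pos
  push_cast
  nlinarith [mul_le_mul_of_nonneg_left h3 hpi.le, mul_le_mul_of_nonneg_left h4 hpi.le]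

lemma appell_den_im (M n : ℤ) (u : ℂ) : ((p * (2 * n - 1) + M) * τ - u : ℂ).im =
    ((p * (2 * n - 1) + M : ℤ) : ℝ) * τ.im - u.im := by
  have h1 : (p * (2 * n - 1) + M : ℂ) = (((p * (2 * n - 1) + M : ℤ) : ℝ) : ℂ) := by push_cast; ring
  rw [h1, Complex.sub_im, Complex.im_ofReal_mul]

/-- All but finitely many denominators of `appellTerm` stay away from `0`, uniformly in a horizontal
strip. -/
lemma finite_small_den (hp : 1 ≤ p) (hτ : 0 < τ.im) (M : ℤ) (R : ℝ) :
    {n : ℤ | ¬ ∀ u : ℂ, |u.im| ≤ R →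
      τ.im ≤ |((p * (2 * n - 1) + M) * τ - u : ℂ).im|}.Finite := by
  obtain ⟨K, hK⟩ := exists_nat_ge (1 + R / τ.im)
  refine (Set.finite_Icc (-(K + p + |M| : ℤ)) (K + p + |M|)).subset fun n hn => ?_
  by_contra hout
  refine hn fun u hu => ?_
  have hbig : (K : ℤ) ≤ |p * (2 * n - 1) + M| := by
    rw [Set.mem_Icc, ← abs_le, not_le] at hout
    have e : p * (2 * n - 1) + M = 2 * (p * n) - (p - M) := by ring
    have h1 : |n| ≤ |p * n| := by
      rw [abs_mul]
      have : (1 : ℤ) ≤ |(p : ℤ)| := by rw [Nat.abs_cast]; exact_mod_cast hp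
      nlinarith [abs_nonneg n]
    have h2 : |2 * (p * n)| - |p - M| ≤ |2 * (p * n) - (p - M)| := abs_sub_abs_le_abs_sub _ _
    have h3 : |(p : ℤ) - M| ≤ p + |M| := by
      refine (abs_sub _ _).trans ?_
      rw [Nat.abs_cast]
    rw [abs_mul, abs_two] at h2
    rw [e]
    have := abs_nonneg n
    linarith
  rw [appell_den_im]
  have hbig' : (K : ℝ) ≤ |((p * (2 * n - 1) + M : ℤ) : ℝ)| := by
    rw [← Int.cast_abs]; exact_mod_cast hbig
  have h5 := abs_sub_abs_le_abs_sub (((p * (2 * n - 1) + M : ℤ) : ℝ) * τ.im) u.im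
  rw [abs_mul, abs_of_pos hτ] at h5
  have h6 : (1 + R / τ.im) * τ.im ≤ |((p * (2 * n - 1) + M : ℤ) : ℝ)| * τ.im := by
    gcongr; exact hK.trans hbig'
  rw [add_mul, one_mul, div_mul_cancel₀ _ hτ.ne'] at h6
  linarith

lemma summable_appellTerm (hp : 1 ≤ p) (hj : 1 ≤ j) (hτ : 0 < τ.im) (M : ℤ) (u : ℂ) :
    Summable (appellTerm p j M τ u) := by
  have hδ := one_sub_exp_pos hτ
  refine Summable.of_norm_bounded_eventually ((summable_appellBound hp hj hτ |u.im|).mul_right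
    (1 - Real.exp (-(2 * Real.pi * τ.im)))⁻¹) ?_
  filter_upwards [(finite_small_den hp hτ M |u.im|).compl_mem_cofinite] with n hn
  have hn' := not_not.1 hn u le_rfl
  rw [appellTerm, norm_div, div_eq_mul_inv]
  have := le_norm_one_sub_ee hn'
  gcongr
  · exact appellBound_nonneg _ _
  · exact norm_appell_num_le hτ le_rfl n

/-- Away from the poles of the retained terms, a partial Appell–Lerch sum is holomorphic. -/
lemma differentiableAt_tsum_indicator_appellTerm (hp : 1 ≤ p) (hj : 1 ≤ j) (hτ : 0 < τ.im)
    (M : ℤ) (N : Set ℤ) {c : ℂ} (hN : ∀ n ∈ N, ee ((p * (2 * n - 1) + M) * τ - c) ≠ 1) :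
    DifferentiableAt ℂ (fun u => ∑' n : ℤ, N.indicator (appellTerm p j M τ u) n) c := by
  classical
  set R := |c.im| + 1 with hR
  set E := {n : ℤ | ¬ ∀ u : ℂ, |u.im| ≤ R → τ.im ≤ |((p * (2 * n - 1) + M) * τ - u : ℂ).im|}
    with hE
  have hEfin : E.Finite := finite_small_den hp hτ M R
  have hδ := one_sub_exp_pos hτ
  -- a lower bound for the denominators near `c`
  set d : ℤ → ℝ := fun n => if n ∈ E then ‖1 - ee ((p * (2 * n - 1) + M) * τ - c)‖ / 2
    else 1 - Real.exp (-(2 * Real.pi * τ.im)) with hd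
  have hdpos : ∀ n ∈ N, 0 < d n := fun n hn => by
    simp only [hd]
    split_ifs
    · exact half_pos (norm_pos_iff.2 (sub_ne_zero.2 (hN n hn).symm))
    · exact hδ
  have hev : ∀ᶠ u in 𝓝 c, |u.im| ≤ R ∧ ∀ n ∈ E, n ∈ N →
      ‖1 - ee ((p * (2 * n - 1) + M) * τ - c)‖ / 2 ≤
        ‖1 - ee ((p * (2 * n - 1) + M) * τ - u)‖ := by
    refine Eventually.and ?_ ((Filter.eventually_all_finite hEfin).2 fun n _ => ?_)
    · have hcont : Continuous fun u : ℂ => |u.im| := by fun_prop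
      exact (hcont.tendsto c).eventually_le_const (by rw [hR]; linarith)
    · by_cases hn : n ∈ N
      · have hcont : Continuous fun u : ℂ => ‖1 - ee ((p * (2 * n - 1) + M) * τ - u)‖ := by
          fun_prop
        have hpos : 0 < ‖1 - ee ((p * (2 * n - 1) + M) * τ - c)‖ :=
          norm_pos_iff.2 (sub_ne_zero.2 (hN n hn).symm)
        exact ((hcont.tendsto c).eventually_const_le (half_lt_self hpos)).mono fun u hu _ => hu
      · exact .of_forall fun u h => absurd h hn
  obtain ⟨U, hU, hUo, hcU⟩ := eventually_nhds_iff.1 hev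
  have hlow : ∀ u ∈ U, ∀ n ∈ N, d n ≤ ‖1 - ee ((p * (2 * n - 1) + M) * τ - u)‖ := by
    intro u hu n hn
    simp only [hd]
    split_ifs with h
    · exact (hU u hu).2 n h hn
    · exact le_norm_one_sub_ee (not_not.1 h u (hU u hu).1)
  have hdiff := differentiableOn_tsum_of_summable_norm
    (u := fun n => N.indicator (fun n => appellBound p j τ R n * (d n)⁻¹) n)
    (F := fun n u => N.indicator (appellTerm p j M τ u) n) (U := U) ?_ ?_ hUo ?_
  · exact hdiff.differentiableAt (hUo.mem_nhds hcU)
  · refine Summable.of_norm_bounded_eventually ((summable_appellBound hp hj hτ R).mul_right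
      (1 - Real.exp (-(2 * Real.pi * τ.im)))⁻¹) ?_
    filter_upwards [hEfin.compl_mem_cofinite] with n hn
    have hnn : 0 ≤ appellBound p j τ R n * (1 - Real.exp (-(2 * Real.pi * τ.im)))⁻¹ :=
      mul_nonneg (Real.exp_pos _).le (inv_nonneg.2 hδ.le)
    have hn' : n ∉ E := hn
    by_cases hnN : n ∈ N
    · rw [Set.indicator_of_mem hnN]
      simp only [hd, if_neg hn']
      rw [Real.norm_of_nonneg hnn]
    · rw [Set.indicator_of_notMem hnN, norm_zero]; exact hnn
  · intro n
    by_cases hnN : n ∈ N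
    · simp only [Set.indicator_of_mem hnN, appellTerm]
      refine DifferentiableOn.div (by fun_prop) (by fun_prop) fun u hu h0 => ?_
      have := hlow u hu n hnN
      rw [h0, norm_zero] at this
      exact absurd (hdpos n hnN) this.not_gt
    · simp only [Set.indicator_of_notMem hnN]; fun_prop
  · intro n u hu
    by_cases hnN : n ∈ N
    · simp only [Set.indicator_of_mem hnN, appellTerm]
      rw [norm_div, div_eq_mul_inv]
      have h1 := hlow u hu n hnN
      have h2 := hdpos n hnN
      have h3 := norm_appell_num_le (p := p) (j := j) hτ (hU u hu).1 n
      gcongr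
      exact appellBound_nonneg _ _
    · simp only [Set.indicator_of_notMem hnN, norm_zero, le_refl]

lemma differentiableAt_appellSum (hp : 1 ≤ p) (hj : 1 ≤ j) (hτ : 0 < τ.im) (M : ℤ) {c : ℂ}
    (hc : ∀ n : ℤ, ee ((p * (2 * n - 1) + M) * τ - c) ≠ 1) :
    DifferentiableAt ℂ (appellSum p j M τ) c := by
  have := differentiableAt_tsum_indicator_appellTerm hp hj hτ M Set.univ (c := c)
    fun n _ => hc n
  simp only [Set.indicator_univ] at this
  exact this

lemma appellSum_add_one (M : ℤ) (u : ℂ) :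
    appellSum p j M τ (u + 1) = appellSum p j M τ u := by
  refine tsum_congr fun n => ?_
  rw [appellTerm, appellTerm]
  congr 1
  · rw [← ee_add_int _ (j * n)]; congr 1; push_cast; ring
  · rw [← ee_add_int _ 1]; congr 2; push_cast; ring

lemma appellSum_add_two_mul (M : ℤ) (u : ℂ) : appellSum p j M τ (u + 2 * p * τ) =
    ee ((p - j * p) * τ - j * u) * appellSum p j M τ u := by
  rw [appellSum, appellSum, ← tsum_mul_left, ← (Equiv.addRight (1 : ℤ)).tsum_eq]
  refine tsum_congr fun n => ?_
  rw [appellTerm, appellTerm, Equiv.coe_addRight, mul_div_assoc', ← ee_add]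
  congr 2
  · push_cast; ring
  · congr 1; push_cast; ring

lemma ee_int_mul_eq_one_iff (hτ : 0 < τ.im) (a : ℤ) : ee (a * τ) = 1 ↔ a = 0 := by
  rw [ee_eq_one_iff]
  constructor
  · rintro ⟨n, hn⟩
    have := congrArg Complex.im hn
    rw [Complex.intCast_im, ← Complex.ofReal_intCast, Complex.im_ofReal_mul] at this
    exact_mod_cast (mul_eq_zero.1 this).resolve_right hτ.ne'
  · rintro rfl
    exact ⟨0, by simp⟩

/-- The residues of the Appell–Lerch sum. -/
lemma tendsto_sub_mul_appellSum (hp : 1 ≤ p) (hj : 1 ≤ j) (hτ : 0 < τ.im) {M e : ℤ}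
    (hM : |M| < p) (he0 : 0 ≤ e) (he : e < 2 * p) :
    Tendsto (fun u => (u - e * τ) * appellSum p j M τ u) (𝓝[≠] (e * τ))
      (𝓝 (if M = e - p then ee ((j * p + p - j * e) * τ) / (2 * Real.pi * Complex.I) else 0)) := by
  rw [abs_lt] at hM
  -- the range of `e` only leaves the pole of the term `n = 1`
  have hw : ∀ n : ℤ, ee ((p * (2 * n - 1) + M) * τ - e * τ) = 1 → n = 1 ∧ M = e - p := by
    intro n hn
    rw [show (p * (2 * n - 1) + M) * τ - e * τ = ((p * (2 * n - 1) + M - e : ℤ) : ℂ) * τ by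
      push_cast; ring, ee_int_mul_eq_one_iff hτ] at hn
    have h1 : n = 1 := by
      have : (0 : ℤ) < p := by exact_mod_cast hp
      have h2 : 0 < n := by nlinarith
      have h3 : n < 2 := by nlinarith
      omega
    subst h1
    exact ⟨rfl, by linarith⟩
  split_ifs with h
  · have h1 : ∀ u, (u - e * τ) * appellSum p j M τ u =
        ee ((j * p + p) * τ - j * u) * ((u - e * τ) / (1 - ee (e * τ - u))) +
        (u - e * τ) * ∑' n : ℤ, ({1}ᶜ : Set ℤ).indicator (appellTerm p j M τ u) n := fun u => by
      rw [appellSum, (summable_appellTerm hp hj hτ M u).tsum_eq_add_tsum_ite 1, mul_add]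
      congr 1
      · rw [appellTerm, h]; push_cast
        rw [show (p * (2 * 1 - 1) + (e - p) : ℂ) = e by ring]
        ring_nf
      · congr 1
        refine tsum_congr fun n => ?_
        by_cases hn : n = 1
        · simp [hn]
        · simp [hn]
    simp only [h1]
    have hd : HasDerivAt (fun u => 1 - ee (e * τ - u)) (2 * Real.pi * Complex.I) (e * τ) := by
      have h2 : HasDerivAt (fun u : ℂ => e * τ - u) (-1) (e * τ) := by
        simpa using (hasDerivAt_id (e * τ : ℂ)).const_sub (e * τ : ℂ)
      have h3 := (HasDerivAt.comp (e * τ : ℂ) (h := fun u : ℂ => e * τ - u)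
        (hasDerivAt_ee _) h2).const_sub 1
      refine h3.congr_deriv ?_
      rw [sub_self, ee_zero]; ring
    have h4 := tendsto_sub_div hd (by rw [sub_self, ee_zero, sub_self]) Complex.two_pi_I_ne_zero
    have hc : Continuous fun u : ℂ => ee ((j * p + p) * τ - j * u) := by fun_prop
    have h5 := ((hc.tendsto (e * τ)).mono_left nhdsWithin_le_nhds).mul h4
    have h6 := tendsto_sub_mul_of_continuousAt (differentiableAt_tsum_indicator_appellTerm hp hj hτ
      M {1}ᶜ (c := e * τ) fun n hn hn1 => hn (hw n hn1).1).continuousAt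
    have h7 := h5.add h6
    rw [add_zero, ← div_eq_mul_inv] at h7
    convert h7 using 4
    ring
  · exact tendsto_sub_mul_of_continuousAt
      (differentiableAt_appellSum hp hj hτ M fun n hn => h (hw n hn).2).continuousAt

/-- In the annulus around the unit circle the Appell–Lerch sum has no Laurent coefficients at
`z ^ (-s)`, `0 ≤ s < j`: the geometric expansion of the `n`-th term only contains powers `z ^ (-k)`
with `k ≥ j` if `n ≥ 1`, and only positive powers of `z` if `n ≤ 0`. -/
lemma integral_appellSum_mul_ee (hp : 1 ≤ p) (hj : 1 ≤ j) (hτ : 0 < τ.im) {M : ℤ}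
    (hM : |M| < p) {s : ℕ} (hs : s < j) :
    ∫ x in (0 : ℝ)..1, appellSum p j M τ x * ee (s * x) = 0 := by
  rw [abs_lt] at hM
  have hp0 : (0 : ℤ) < p := by exact_mod_cast hp
  have hδ := one_sub_exp_pos hτ
  have hne : ∀ n : ℤ, 1 ≤ |p * (2 * n - 1) + M| := fun n => by
    refine Int.one_le_abs fun h => ?_
    rcases lt_or_ge n 1 with h1 | h1 <;> nlinarith
  have him : ∀ (n : ℤ) (x : ℝ), τ.im ≤ |((p * (2 * n - 1) + M) * τ - x : ℂ).im| := fun n x => by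
    rw [appell_den_im, Complex.ofReal_im, sub_zero, abs_mul, abs_of_pos hτ, ← Int.cast_abs]
    have : (1 : ℝ) ≤ (|p * (2 * n - 1) + M| : ℤ) := by exact_mod_cast hne n
    nlinarith
  have hlow : ∀ (n : ℤ) (x : ℝ), 1 - Real.exp (-(2 * Real.pi * τ.im)) ≤
      ‖1 - ee ((p * (2 * n - 1) + M) * τ - x)‖ := fun n x => le_norm_one_sub_ee (him n x)
  have hne0 : ∀ (n : ℤ) (x : ℝ), 1 - ee ((p * (2 * n - 1) + M) * τ - x) ≠ 0 := fun n x h => by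
    have := hlow n x
    rw [h, norm_zero] at this
    linarith
  have hsum := hasSum_integral_of_norm_le
    (F := fun (n : ℤ) (x : ℝ) => appellTerm p j M τ x n * ee (s * x))
    (f := fun x => appellSum p j M τ x * ee (s * x))
    (b := fun n => appellBound p j τ 0 n * (1 - Real.exp (-(2 * Real.pi * τ.im)))⁻¹)
    (fun n => by
      simp only [appellTerm]
      exact (Continuous.div (by fun_prop) (by fun_prop) (hne0 n)).mul (by fun_prop))
    ((summable_appellBound hp hj hτ 0).mul_right _)
    (fun n x => by
      rw [norm_mul, norm_ee, appellTerm, norm_div, div_eq_mul_inv]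
      have h1 := hlow n x
      have h2 := norm_appell_num_le (p := p) (j := j) hτ (R := 0) (u := x) (by simp) n
      have h3 : Real.exp (-(2 * Real.pi * (s * x : ℂ).im)) = 1 := by simp
      rw [h3, mul_one]
      gcongr
      exact appellBound_nonneg _ _)
    (fun x => (summable_appellTerm hp hj hτ M x).hasSum.mul_right _)
  refine hsum.unique ?_
  convert hasSum_zero with n
  rcases lt_or_ge 0 n with hn | hn
  · -- here `|q ^ (p (2 n - 1) + M)| < 1`
    have ha : 0 < ((p * (2 * n - 1) + M) * τ : ℂ).im := by
      have h := appell_den_im (p := p) (τ := τ) M n 0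
      rw [sub_zero, Complex.zero_im, sub_zero] at h
      rw [h]
      have : 0 < p * (2 * n - 1) + M := by nlinarith
      have : (0 : ℝ) < (p * (2 * n - 1) + M : ℤ) := by exact_mod_cast this
      positivity
    obtain ⟨k, hk⟩ : ∃ k : ℕ, (k : ℤ) = j * n - s := ⟨(j * n - s).toNat, by
      rw [Int.toNat_of_nonneg]; nlinarith⟩
    have hk1 : 1 ≤ k := by
      have : (1 : ℤ) ≤ k := by rw [hk]; nlinarith
      exact_mod_cast this
    have hkc : (k : ℂ) = j * n - s := by exact_mod_cast congrArg (Int.cast (R := ℂ)) hk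
    rw [← mul_zero (ee ((j * p * n ^ 2 + n * p) * τ)), ← integral_ee_neg_div_one_sub_eq_zero ha hk1,
      ← intervalIntegral.integral_const_mul]
    refine intervalIntegral.integral_congr fun x _ => ?_
    simp only [appellTerm]
    rw [div_mul_eq_mul_div, ← ee_add, mul_div_assoc', ← ee_add, hkc]
    congr 2; ring
  · -- here `|q ^ (p (2 n - 1) + M)| > 1`, and one expands in its inverse
    have ha : 0 < (-((p * (2 * n - 1) + M) * τ) : ℂ).im := by
      have h := appell_den_im (p := p) (τ := τ) M n 0
      rw [sub_zero, Complex.zero_im, sub_zero] at h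
      rw [Complex.neg_im, h]
      have : 0 < -(p * (2 * n - 1) + M) := by nlinarith
      have : (0 : ℝ) < ((-(p * (2 * n - 1) + M) : ℤ) : ℝ) := by exact_mod_cast this
      rw [Int.cast_neg] at this
      nlinarith
    obtain ⟨k, hk⟩ : ∃ k : ℕ, (k : ℤ) = s + 1 - j * n := ⟨(s + 1 - j * n).toNat, by
      rw [Int.toNat_of_nonneg]; nlinarith⟩
    have hk1 : 1 ≤ k := by
      have : (1 : ℤ) ≤ k := by rw [hk]; nlinarith
      exact_mod_cast this
    have hkc : (k : ℂ) = s + 1 - j * n := by exact_mod_cast congrArg (Int.cast (R := ℂ)) hk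
    rw [← mul_zero (-ee ((j * p * n ^ 2 + n * p) * τ - (p * (2 * n - 1) + M) * τ)),
      ← integral_ee_div_one_sub_eq_zero ha hk1, ← intervalIntegral.integral_const_mul]
    refine intervalIntegral.integral_congr fun x _ => ?_
    simp only [appellTerm]
    have h1 := hne0 n x
    have h2 : 1 - ee (-((p * (2 * n - 1) + M) * τ) + x) =
        -(1 - ee ((p * (2 * n - 1) + M) * τ - x)) / ee ((p * (2 * n - 1) + M) * τ - x) := by
      rw [show -((p * (2 * n - 1) + M) * τ) + x = -((p * (2 * n - 1) + M) * τ - x) by ring, ee_neg]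
      have := ee_ne_zero ((p * (2 * n - 1) + M) * τ - x)
      field_simp; ring
    rw [h2, div_mul_eq_mul_div, ← ee_add, div_div_eq_mul_div, ← ee_add, mul_div_assoc', div_neg,
      neg_mul, neg_div, neg_neg, ← ee_add, hkc]
    congr 2; ring

end appell

/-! ### The polar part -/

/-- The series of the Appell function, after clearing the theta function in front. -/
lemma jTheta_mul_appellM {t : ℂ} (ht : 0 < t.im) {a b : ℂ}
    (hb : ∀ n : ℤ, -ee b ≠ ee t ^ n) :
    jTheta (-ee b) (ee t) * appellM (-ee a) (-ee b) (ee t) =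
      ∑' n : ℤ, ee (n * (n - 1) / 2 * t + n * b) / (1 - ee ((n - 1) * t + (a + b))) := by
  have hJ : jTheta (-ee b) (ee t) ≠ 0 := by
    rw [neg_ee] at hb ⊢
    exact jTheta_ne_zero ht hb
  rw [appellM, ← mul_assoc, mul_one_div_cancel hJ, one_mul]
  refine tsum_congr fun n => ?_
  have h1 : ((n * (n - 1) / 2 : ℤ) : ℂ) = n * (n - 1) / 2 := by
    rw [Int.cast_div (Int.even_mul_pred_self n).two_dvd (by norm_num)]; push_cast; ring
  have h2 : (-1 : ℂ) ^ n * (-1 : ℂ) ^ n = 1 := by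
    rw [← mul_zpow]; simp
  rw [ee_zpow, ee_zpow, h1, neg_eq_neg_one_mul (ee b), mul_zpow, ee_zpow, ee_add, ee_add, ee_add]
  congr 1
  · linear_combination ee (n * (n - 1) / 2 * t) * ee (n * b) * h2
  · push_cast; ring

lemma AppellDefined.ee_ne_one {a b t : ℂ} (h : AppellDefined (-ee a) (-ee b) (ee t)) (n : ℤ) :
    ee ((n - 1) * t + (a + b)) ≠ 1 := by
  intro h1
  refine h.2 (1 - n) ?_
  rw [neg_mul_neg, ← ee_add, ee_zpow]
  have h2 : ee (a + b) = ee (((1 - n : ℤ) : ℂ) * t) * ee ((n - 1) * t + (a + b)) := by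
    rw [← ee_add]; congr 1; push_cast; ring
  rw [h2, h1, mul_one]

/-- The geometric sum that replaces a denominator `1 - w ^ j` by `1 - w`. -/
lemma sum_pow_div_one_sub_pow {w : ℂ} {j : ℕ} (h : w ^ j ≠ 1) :
    (∑ s ∈ range j, w ^ s) / (1 - w ^ j) = 1 / (1 - w) := by
  have h1 : w ≠ 1 := fun h1 => h (by rw [h1, one_pow])
  have h2 : 1 - w ^ j ≠ 0 := sub_ne_zero.2 h.symm
  have h3 : 1 - w ≠ 0 := sub_ne_zero.2 h1.symm
  rw [div_eq_div_iff h2 h3, one_mul]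
  have := geom_sum_mul w j
  linear_combination -this

section polar

variable {p j r : ℕ} {τ : ℂ}

lemma summable_theta_div (hp : 1 ≤ p) (hj : 1 ≤ j) (hτ : 0 < τ.im) (M : ℤ) (u v : ℂ) {t : ℂ}
    (ht : 0 < t.im) :
    Summable fun n : ℤ => ee (n * v + n ^ 2 * t / 2) /
      (1 - ee (j * ((p * (2 * n - 1) + M) * τ - u))) := by
  have hδ := one_sub_exp_pos hτ
  refine Summable.of_norm_bounded_eventually ((summable_ee_theta v ht).norm.mul_right
    (1 - Real.exp (-(2 * Real.pi * τ.im)))⁻¹) ?_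
  filter_upwards [(finite_small_den hp hτ M |u.im|).compl_mem_cofinite] with n hn
  have hn' := not_not.1 hn u le_rfl
  have h1 : τ.im ≤ |(j * ((p * (2 * n - 1) + M) * τ - u) : ℂ).im| := by
    rw [← Complex.ofReal_natCast j, Complex.im_ofReal_mul, abs_mul, Nat.abs_cast]
    have : (1 : ℝ) ≤ j := by exact_mod_cast hj
    nlinarith
  rw [norm_div, div_eq_mul_inv]
  have := le_norm_one_sub_ee h1
  gcongr

lemma im_two_mul_pos (hp : 1 ≤ p) (hj : 1 ≤ j) (hτ : 0 < τ.im) :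
    0 < (2 * j * p * τ : ℂ).im := by
  have := im_nat_mul_pos (n := 2 * j * p) (by nlinarith) hτ
  simpa using this

/-- The first family of Appell functions sums to an Appell–Lerch sum. -/
lemma sum_tsum_eq_appellSum (hp : 1 ≤ p) (hj : 1 ≤ j) (hτ : 0 < τ.im) (m : ℕ) {u : ℂ}
    (hne : ∀ n : ℤ, ee (j * ((p * (2 * n - 1) + m) * τ - u)) ≠ 1) :
    ∑ s ∈ range j, ee ((p * s + (m * (s + 1) - p * (2 * s + 1))) * τ - s * u) *
      ∑' n : ℤ, ee (n * (n - 1) / 2 * (2 * j * p * τ) + n * (p * (j + 2 * s + 1) * τ - j * u)) /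
        (1 - ee ((n - 1) * (2 * j * p * τ) +
          ((j * m - p * (2 * s + 1)) * τ + (p * (j + 2 * s + 1) * τ - j * u)))) =
    ee ((m - p) * τ) * appellSum p j m τ u := by
  -- the denominators do not depend on `s`
  have hden : ∀ (s : ℕ) (n : ℤ), (n - 1) * (2 * j * p * τ) +
      ((j * m - p * (2 * s + 1)) * τ + (p * (j + 2 * s + 1) * τ - j * u)) =
      j * ((p * (2 * n - 1) + m) * τ - u) := fun s n => by ring
  simp only [hden, ← tsum_mul_left]
  rw [← Summable.tsum_finsetSum, appellSum, ← tsum_mul_left]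
  · refine tsum_congr fun n => ?_
    have hw := hne n
    rw [← ee_pow] at hw
    have hg := sum_pow_div_one_sub_pow hw
    rw [appellTerm, div_eq_mul_one_div (ee _), Int.cast_natCast, ← hg, ← ee_pow,
      mul_div_assoc', mul_div_assoc', mul_sum, mul_sum, sum_div]
    refine sum_congr rfl fun s _ => ?_
    rw [mul_div_assoc', ee_pow _ j, ee_pow _ s, ← ee_add, ← ee_add, ← ee_add]
    congr 2; ring
  · intro s _
    refine Summable.mul_left _ ?_
    refine (summable_theta_div hp hj hτ m u (p * (j + 2 * s + 1) * τ - j * u - j * p * τ)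
      (im_two_mul_pos hp hj hτ)).congr fun n => ?_
    rw [Int.cast_natCast]
    congr 2; ring

/-- The second family of Appell functions is turned into an Appell–Lerch sum of the first kind, of
opposite residue class, by the substitution `n ↦ 1 - n`. -/
lemma sum_tsum_eq_neg_appellSum (hp : 1 ≤ p) (hj : 1 ≤ j) (hτ : 0 < τ.im) (m : ℕ) {u : ℂ}
    (hne : ∀ n : ℤ, ee (j * ((p * (2 * n - 1) + m) * τ + u)) ≠ 1) :
    ∑ s ∈ range j, ee ((p * s - m * s) * τ - s * u) *
      ∑' n : ℤ, ee (n * (n - 1) / 2 * (2 * j * p * τ) + n * (p * (j - 2 * s - 1) * τ + j * u)) /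
        (1 - ee ((n - 1) * (2 * j * p * τ) +
          ((j * m + p * (2 * s + 1)) * τ + (p * (j - 2 * s - 1) * τ + j * u)))) =
    -(ee ((-p - j * m) * τ) * appellSum p j (-m) τ u) := by
  have hden : ∀ (s : ℕ) (n : ℤ), (n - 1) * (2 * j * p * τ) +
      ((j * m + p * (2 * s + 1)) * τ + (p * (j - 2 * s - 1) * τ + j * u)) =
      j * ((p * (2 * n - 1) + m) * τ + u) := fun s n => by ring
  simp only [hden, ← tsum_mul_left]
  rw [← Summable.tsum_finsetSum, appellSum, ← tsum_mul_left, ← tsum_neg,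
    ← (Equiv.subLeft (1 : ℤ)).tsum_eq]
  · refine tsum_congr fun n => ?_
    rw [Equiv.subLeft_apply]
    have hw := hne (1 - n)
    have hx : (j * ((p * (2 * ((1 - n : ℤ) : ℂ) - 1) + m) * τ + u)) =
        -(j * ((p * (2 * n - 1) + (-m : ℤ)) * τ - u)) := by push_cast; ring
    rw [hx, ee_neg, ← ee_pow] at hw
    have hw' : ee ((p * (2 * n - 1) + (-m : ℤ)) * τ - u) ^ j ≠ 1 := fun h => hw (by rw [h, inv_one])
    have hg := sum_pow_div_one_sub_pow hw'
    have hw0 : ee ((p * (2 * n - 1) + (-m : ℤ)) * τ - u) ^ j ≠ 0 := pow_ne_zero _ (ee_ne_zero _)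
    have h1 : 1 - ee ((p * (2 * n - 1) + (-m : ℤ)) * τ - u) ^ j ≠ 0 := sub_ne_zero.2 hw'.symm
    have hinv : ∀ y : ℂ, y / (1 - (ee ((p * (2 * n - 1) + (-m : ℤ)) * τ - u) ^ j)⁻¹) =
        -(y * ee ((p * (2 * n - 1) + (-m : ℤ)) * τ - u) ^ j) /
          (1 - ee ((p * (2 * n - 1) + (-m : ℤ)) * τ - u) ^ j) := fun y => by
      rw [eq_div_iff h1, div_mul_eq_mul_div, div_eq_iff (sub_ne_zero.2 hw.symm)]
      field_simp; ring
    rw [appellTerm, div_eq_mul_one_div (ee _) (1 - ee _), ← hg, hx, ee_neg, ← ee_pow]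
    simp only [hinv]
    rw [mul_div_assoc', mul_div_assoc', mul_sum, mul_sum, sum_div, ← sum_neg_distrib]
    refine sum_congr rfl fun s _ => ?_
    rw [mul_div_assoc', mul_neg, neg_div]
    congr 2
    rw [ee_pow, ee_pow, ← ee_add, ← ee_add, ← ee_add, ← ee_add]
    congr 1; push_cast; ring
  · intro s _
    refine Summable.mul_left _ ?_
    refine (summable_theta_div hp hj hτ m (-u) (p * (j - 2 * s - 1) * τ + j * u - j * p * τ)
      (im_two_mul_pos hp hj hτ)).congr fun n => ?_
    rw [Int.cast_natCast, sub_neg_eq_add]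
    congr 2; ring

/-- The coefficient `(-1) ^ m q ^ (m (m + 1) / 2 + m (r - p)) B_m` of the polar part. -/
def polarCoeff (p j r : ℕ) (τ : ℂ) (m : ℕ) : ℂ :=
  (-1) ^ m * ee ((m * (m + 1) / 2 + m * (r - p)) * τ) * polarTheta p (2 * p + j) r τ m

/-- The prefactor of the polar part. -/
def polarConst (p j r : ℕ) (τ : ℂ) : ℂ :=
  1 / qPochInf (ee τ) (ee τ) ^ 3 * ((-1) ^ p *
    ee ((-(1 / 8) + p * (r + 1) ^ 2 / (2 * p + j) + (p * (p - 1) / 2 - p * r)) * τ))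

/-- The polar part without its prefactor, in terms of Appell–Lerch sums. -/
def polarSum (p j r : ℕ) (τ u : ℂ) : ℂ :=
  ∑ m ∈ Ico 1 p, polarCoeff p j r τ m * (ee ((m - p) * τ) * appellSum p j m τ u -
    ee ((-p - j * m) * τ) * appellSum p j (-m) τ u)

/-- The polar part of the character. -/
def polarPart (p j r : ℕ) (τ u : ℂ) : ℂ :=
  polarConst p j r τ * (ee (-(u / 2)) * polarSum p j r τ u)

lemma jTheta_sub_eq_polarTheta (hp : 1 ≤ p) (hτ : 0 < τ.im) (m : ℕ) :
    jTheta (-epow τ (m * (2 * p + j) + p * (2 * r + 2))) (epow τ (2 * p * (2 * p + j))) -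
      epow τ (m * (2 * p + j) - m * (2 * r + 2)) *
        jTheta (-epow τ (-(m * (2 * p + j)) + p * (2 * r + 2))) (epow τ (2 * p * (2 * p + j))) =
    polarTheta p (2 * p + j) r τ m := by
  have him : 0 < (2 * p * (2 * p + j) * τ : ℂ).im := by
    have := im_nat_mul_pos (n := 2 * p * (2 * p + j)) (by nlinarith) hτ
    simpa using this
  simp only [epow_eq_ee]
  rw [jTheta_neg_eq_jacobiTheta₂ him, jTheta_neg_eq_jacobiTheta₂ him, polarTheta]
  push_cast
  congr 2
  · ring
  · congr 1; ring
  · congr 1; ring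

/-- Summing over `s` turns the Appell functions of the theorem into Appell–Lerch sums. -/
lemma polarPart_eq (hp : 1 ≤ p) (hj : 1 ≤ j) (hτ : 0 < τ.im) {u : ℂ}
    (hdef : ∀ s ∈ Finset.range j, ∀ m ∈ Finset.Ico 1 p,
        AppellDefined (-epow τ (j * m - p * (2 * s + 1)))
            (-epow τ (p * (j + 2 * s + 1)) * epow u (-j)) (epow τ (2 * j * p)) ∧
        AppellDefined (-epow τ (j * m + p * (2 * s + 1)))
            (-epow τ (p * (j - 2 * s - 1)) * epow u j) (epow τ (2 * j * p))) :
    1 / qPochInf (epow τ 1) (epow τ 1) ^ 3 *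
          ∑ s ∈ Finset.range j,
            (-1) ^ p * epow τ (-(1 / 8) + p * (2 * r + 2) ^ 2 / (4 * (2 * p + j))) *
              epow τ (p * (p - 1) / 2 - p * (r - s)) * epow u (-((2 * s + 1) / 2)) *
              jTheta (-epow τ (p * (j - 2 * s - 1)) * epow u j) (epow τ (2 * j * p)) *
              ∑ m ∈ Finset.Ico 1 p,
                (-1) ^ m * epow τ (m * (m + 1) / 2 + m * (r - p)) *
                  (jTheta (-epow τ (m * (2 * p + j) + p * (2 * r + 2)))
                      (epow τ (2 * p * (2 * p + j))) -
                    epow τ (m * (2 * p + j) - m * (2 * r + 2)) *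
                      jTheta (-epow τ (-(m * (2 * p + j)) + p * (2 * r + 2)))
                        (epow τ (2 * p * (2 * p + j)))) *
                  (epow τ (m * (s + 1) - p * (2 * s + 1)) *
                      appellM (-epow τ (j * m - p * (2 * s + 1)))
                        (-epow τ (p * (j + 2 * s + 1)) * epow u (-j)) (epow τ (2 * j * p)) +
                    epow τ (-(m * s)) *
                      appellM (-epow τ (j * m + p * (2 * s + 1)))
                        (-epow τ (p * (j - 2 * s - 1)) * epow u j) (epow τ (2 * j * p))) =
      polarPart p j r τ u := by
  have hT := im_two_mul_pos hp hj hτ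
  simp only [jTheta_sub_eq_polarTheta hp hτ]
  simp only [epow_eq_ee, one_mul, neg_mul (ee _), ← ee_add] at hdef ⊢
  set X₁ : ℕ → ℕ → ℂ := fun s m =>
    ∑' n : ℤ, ee (n * (n - 1) / 2 * (2 * j * p * τ) + n * (p * (j + 2 * s + 1) * τ - j * u)) /
        (1 - ee ((n - 1) * (2 * j * p * τ) +
          ((j * m - p * (2 * s + 1)) * τ + (p * (j + 2 * s + 1) * τ - j * u)))) with hX₁
  set X₂ : ℕ → ℕ → ℂ := fun s m =>
    ∑' n : ℤ, ee (n * (n - 1) / 2 * (2 * j * p * τ) + n * (p * (j - 2 * s - 1) * τ + j * u)) /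
        (1 - ee ((n - 1) * (2 * j * p * τ) +
          ((j * m + p * (2 * s + 1)) * τ + (p * (j - 2 * s - 1) * τ + j * u)))) with hX₂
  have h₁ : ∀ s ∈ range j, ∀ m ∈ Ico 1 p,
      jTheta (-ee (p * (j - 2 * s - 1) * τ + j * u)) (ee (2 * j * p * τ)) *
        appellM (-ee ((j * m - p * (2 * s + 1)) * τ)) (-ee (p * (j + 2 * s + 1) * τ + -j * u))
          (ee (2 * j * p * τ)) = X₁ s m := by
    intro s hs m hm
    -- the two theta functions agree by `j(Q / x; Q) = j(x; Q)`
    have hJ : jTheta (-ee (p * (j - 2 * s - 1) * τ + j * u)) (ee (2 * j * p * τ)) =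
        jTheta (-ee (p * (j + 2 * s + 1) * τ + -j * u)) (ee (2 * j * p * τ)) := by
      rw [jTheta_neg_eq_jacobiTheta₂ hT, jTheta_neg_eq_jacobiTheta₂ hT, ← jacobiTheta₂_neg_left]
      congr 1; ring
    rw [hJ, jTheta_mul_appellM hT (hdef s hs m hm).1.1, hX₁, neg_mul, ← sub_eq_add_neg]
  have h₂ : ∀ s ∈ range j, ∀ m ∈ Ico 1 p,
      jTheta (-ee (p * (j - 2 * s - 1) * τ + j * u)) (ee (2 * j * p * τ)) *
        appellM (-ee ((j * m + p * (2 * s + 1)) * τ)) (-ee (p * (j - 2 * s - 1) * τ + j * u))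
          (ee (2 * j * p * τ)) = X₂ s m :=
    fun s hs m hm => jTheta_mul_appellM hT (hdef s hs m hm).2.1
  have hterm : ∀ s ∈ range j, ∀ m ∈ Ico 1 p,
      (-1) ^ p * ee ((-(1 / 8) + p * (2 * r + 2) ^ 2 / (4 * (2 * p + j))) * τ) *
              ee ((p * (p - 1) / 2 - p * (r - s)) * τ) * ee (-((2 * s + 1) / 2) * u) *
              jTheta (-ee (p * (j - 2 * s - 1) * τ + j * u)) (ee (2 * j * p * τ)) *
              ((-1) ^ m * ee ((m * (m + 1) / 2 + m * (r - p)) * τ) *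
                  polarTheta p (2 * p + j) r τ m *
                  (ee ((m * (s + 1) - p * (2 * s + 1)) * τ) *
                      appellM (-ee ((j * m - p * (2 * s + 1)) * τ))
                        (-ee (p * (j + 2 * s + 1) * τ + -j * u)) (ee (2 * j * p * τ)) +
                    ee (-(m * s) * τ) *
                      appellM (-ee ((j * m + p * (2 * s + 1)) * τ))
                        (-ee (p * (j - 2 * s - 1) * τ + j * u)) (ee (2 * j * p * τ)))) =
      (-1) ^ p *
    ee ((-(1 / 8) + p * (r + 1) ^ 2 / (2 * p + j) + (p * (p - 1) / 2 - p * r)) * τ) *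
      ee (-(u / 2)) * polarCoeff p j r τ m *
        (ee ((p * s + (m * (s + 1) - p * (2 * s + 1))) * τ - s * u) * X₁ s m +
          ee ((p * s - m * s) * τ - s * u) * X₂ s m) := by
    intro s hs m hm
    rw [← h₁ s hs m hm, ← h₂ s hs m hm, polarCoeff]
    have e0 : ee ((-(1 / 8) + p * (2 * r + 2) ^ 2 / (4 * (2 * p + j))) * τ) *
              ee ((p * (p - 1) / 2 - p * (r - s)) * τ) * ee (-((2 * s + 1) / 2) * u) =
        ee ((-(1 / 8) + p * (r + 1) ^ 2 / (2 * p + j) + (p * (p - 1) / 2 - p * r)) * τ) *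
          ee (-(u / 2)) * ee (p * s * τ - s * u) := by
      have : (2 * p + j : ℂ) ≠ 0 := by
        have : 2 * p + j ≠ 0 := by omega
        exact_mod_cast this
      simp only [← ee_add]
      congr 1; field_simp; ring
    have e1 : ee ((p * s + (m * (s + 1) - p * (2 * s + 1))) * τ - s * u) =
        ee (p * s * τ - s * u) * ee ((m * (s + 1) - p * (2 * s + 1)) * τ) := by
      rw [← ee_add]; congr 1; ring
    have e2 : ee ((p * s - m * s) * τ - s * u) = ee (p * s * τ - s * u) * ee (-(m * s) * τ) := by
      rw [← ee_add]; congr 1; ring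
    rw [e1, e2, mul_assoc ((-1) ^ p) (ee _) (ee _), mul_assoc ((-1) ^ p) (_ * _) (ee _), e0]
    ring
  rw [polarPart, polarConst, mul_assoc (1 / _ : ℂ)]
  congr 1
  simp only [mul_sum]
  rw [sum_congr rfl fun s hs => sum_congr rfl (hterm s hs), sum_comm, polarSum, ← mul_assoc,
    mul_sum]
  refine sum_congr rfl fun m hm => ?_
  have h0 : 0 ∈ range j := mem_range.2 hj
  have hd := hdef 0 h0 m hm
  rw [← mul_sum, sum_add_distrib, sum_tsum_eq_appellSum hp hj hτ m, sum_tsum_eq_neg_appellSum hp hj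
    hτ m]
  · ring
  · intro n
    have := hd.2.ee_ne_one n
    convert this using 2
    push_cast; ring
  · intro n
    have := hd.1.ee_ne_one n
    convert this using 2
    push_cast; ring

end polar

/-! ### Poles and residues -/

lemma neg_one_pow_eq_ee (n : ℕ) : (-1 : ℂ) ^ n = ee (n / 2) := by
  rw [← ee_half, ee_pow]; congr 1; ring

lemma denTheta_eq_zero_iff {τ : ℂ} (hτ : 0 < τ.im) (u : ℂ) :
    denTheta τ u = 0 ↔ ∃ n : ℤ, ee u = ee τ ^ n := by
  refine ⟨fun h => ?_, fun ⟨n, hn⟩ => ?_⟩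
  · by_contra! h'
    exact denTheta_ne_zero hτ h' h
  · have h0 := denTheta_int_mul hτ n
    rw [denTheta_eq_jTheta hτ] at h0 ⊢
    rw [hn, ee_zpow, (mul_eq_zero.1 h0).resolve_left (ee_ne_zero _), mul_zero]

lemma exists_eq_of_denTheta_eq_zero {τ : ℂ} (hτ : 0 < τ.im) {u : ℂ} (h : denTheta τ u = 0) :
    ∃ n b : ℤ, u = n * τ + b := by
  obtain ⟨n, hn⟩ := (denTheta_eq_zero_iff hτ u).1 h
  have h1 : ee (u - n * τ) = 1 := by rw [ee_sub, hn, ee_zpow, div_self (ee_ne_zero _)]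
  obtain ⟨b, hb⟩ := (ee_eq_one_iff _).1 h1
  exact ⟨n, b, by rw [← hb]; ring⟩

lemma denTheta_ne_zero_of_im {τ : ℂ} (hτ : 0 < τ.im) {u : ℂ} (hu : |u.im| < τ.im)
    (h : ee u ≠ 1) : denTheta τ u ≠ 0 := by
  intro h0
  obtain ⟨n, b, rfl⟩ := exists_eq_of_denTheta_eq_zero hτ h0
  have him : (n * τ + b : ℂ).im = n * τ.im := by
    rw [Complex.add_im, Complex.intCast_im, add_zero, ← Complex.ofReal_intCast,
      Complex.im_ofReal_mul]
  rw [him, abs_mul, abs_of_pos hτ] at hu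
  have h1 : |(n : ℝ)| < 1 := by
    by_contra! h2
    nlinarith
  have hn : n = 0 := by
    rw [← Int.cast_abs] at h1
    exact Int.abs_lt_one_iff.1 (by exact_mod_cast h1)
  exact h (by rw [hn, Int.cast_zero, zero_mul, zero_add, ee_int])

lemma eventually_denTheta_ne_zero {τ : ℂ} (hτ : 0 < τ.im) (c : ℂ) :
    ∀ᶠ z in 𝓝[≠] c, denTheta τ z ≠ 0 := by
  have han : AnalyticOnNhd ℂ (denTheta τ) Set.univ :=
    (differentiable_denTheta hτ).differentiableOn.analyticOnNhd isOpen_univ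
  rcases (han c trivial).eventually_eq_zero_or_eventually_ne_zero with h | h
  · exfalso
    have h0 := han.eqOn_zero_of_preconnected_of_eventuallyEq_zero isPreconnected_univ
      (Set.mem_univ c) h (Set.mem_univ (τ / 2))
    refine denTheta_ne_zero_of_im hτ (u := τ / 2) ?_ (fun h1 => ?_) h0
    · rw [show τ / 2 = ((1 / 2 : ℝ) : ℂ) * τ by push_cast; ring, Complex.im_ofReal_mul, abs_mul,
        abs_of_pos hτ, abs_of_pos (by norm_num)]
      linarith
    · have h2 := norm_ee_lt_one (x := τ / 2) (by
        rw [show τ / 2 = ((1 / 2 : ℝ) : ℂ) * τ by push_cast; ring, Complex.im_ofReal_mul]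
        positivity)
      rw [h1, norm_one] at h2
      exact lt_irrefl _ h2
  · exact h

section poles

variable {p j r : ℕ} {τ : ℂ}

lemma differentiableAt_admChar (hp : 1 ≤ p) (hτ : 0 < τ.im) {c : ℂ} (hc : denTheta τ c ≠ 0) :
    DifferentiableAt ℂ (fun u => admChar p (2 * p + j) (2 * r + 1) u τ) c := by
  have hp' : 1 ≤ 2 * p + j := by omega
  rw [show (fun u => admChar p (2 * p + j) (2 * r + 1) u τ) = _ from
    funext fun u => admChar_eq_div hp' u τ]
  exact (differentiable_numTheta hp hp' hτ c).div (differentiable_denTheta hτ c) hc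

lemma hasDerivAt_denTheta_ne_zero (hτ : 0 < τ.im) (n : ℤ) :
    -(2 * Real.pi * Complex.I) * ee (τ / 8 + n / 2 - n ^ 2 * τ / 2) *
      qPochInf (ee τ) (ee τ) ^ 3 ≠ 0 :=
  mul_ne_zero (mul_ne_zero (neg_ne_zero.2 Complex.two_pi_I_ne_zero) (ee_ne_zero _))
    (pow_ne_zero _ (qPochInf_self_ne_zero (norm_ee_lt_one hτ)))

/-- The residues of the character. -/
lemma tendsto_sub_mul_admChar (hp : 1 ≤ p) (hτ : 0 < τ.im) (e : ℤ) :
    Tendsto (fun u => (u - e * τ) * admChar p (2 * p + j) (2 * r + 1) u τ) (𝓝[≠] (e * τ))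
      (𝓝 (numTheta p (2 * p + j) r τ (e * τ) *
        (-(2 * Real.pi * Complex.I) * ee (τ / 8 + e / 2 - e ^ 2 * τ / 2) *
          qPochInf (ee τ) (ee τ) ^ 3)⁻¹)) := by
  have hp' : 1 ≤ 2 * p + j := by omega
  have h1 := tendsto_sub_div (hasDerivAt_denTheta hτ e) (denTheta_int_mul hτ e)
    (hasDerivAt_denTheta_ne_zero hτ e)
  have h2 := ((differentiable_numTheta (r := r) hp hp' hτ).continuous.tendsto
    (e * τ)).mono_left (nhdsWithin_le_nhds (s := {(e * τ : ℂ)}ᶜ))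
  refine (h2.mul h1).congr fun u => ?_
  rw [admChar_eq_div hp']; ring

lemma isQuasiPeriod_admChar_one (hp : 1 ≤ p) (hτ : 0 < τ.im) :
    IsQuasiPeriod (fun u => admChar p (2 * p + j) (2 * r + 1) u τ) 1 :=
  ⟨fun _ => -1, continuous_const, fun _ => by norm_num, fun u => by
    simp only
    rw [admChar_add_one (by omega) hτ, neg_one_mul]⟩

lemma ee_ne_one_of_denTheta_ne_zero (hτ : 0 < τ.im) {c : ℂ} (hc : denTheta τ c ≠ 0) (a : ℤ) :
    ee (a * τ - c) ≠ 1 := fun h => by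
  refine hc ((denTheta_eq_zero_iff hτ c).2 ⟨a, ?_⟩)
  rw [ee_sub, div_eq_one_iff_eq (ee_ne_zero _)] at h
  rw [← h, ee_zpow]

lemma differentiableAt_polarSum (hp : 1 ≤ p) (hj : 1 ≤ j) (hτ : 0 < τ.im) {c : ℂ}
    (hc : ∀ M : ℤ, |M| < p → ∀ n : ℤ, ee ((p * (2 * n - 1) + M) * τ - c) ≠ 1) :
    DifferentiableAt ℂ (polarSum p j r τ) c := by
  refine DifferentiableAt.fun_sum fun m hm => ?_
  have hm' := mem_Ico.1 hm
  have h1 := differentiableAt_appellSum hp hj hτ m (c := c)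
    (hc m (by rw [Nat.abs_cast]; exact_mod_cast hm'.2))
  have h2 := differentiableAt_appellSum hp hj hτ (-m) (c := c)
    (hc (-m) (by rw [abs_neg, Nat.abs_cast]; exact_mod_cast hm'.2))
  exact ((h1.const_mul _).sub (h2.const_mul _)).const_mul _

lemma differentiableAt_polarPart (hp : 1 ≤ p) (hj : 1 ≤ j) (hτ : 0 < τ.im) {c : ℂ}
    (hc : ∀ M : ℤ, |M| < p → ∀ n : ℤ, ee ((p * (2 * n - 1) + M) * τ - c) ≠ 1) :
    DifferentiableAt ℂ (polarPart p j r τ) c := by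
  have h := differentiableAt_polarSum (r := r) hp hj hτ hc
  have h1 : DifferentiableAt ℂ (fun u : ℂ => ee (-(u / 2))) c := by fun_prop
  exact (h1.mul h).const_mul _

lemma differentiableAt_polarPart_of_denTheta (hp : 1 ≤ p) (hj : 1 ≤ j) (hτ : 0 < τ.im) {c : ℂ}
    (hc : denTheta τ c ≠ 0) : DifferentiableAt ℂ (polarPart p j r τ) c :=
  differentiableAt_polarPart hp hj hτ fun M _ n => by
    have := ee_ne_one_of_denTheta_ne_zero hτ hc (p * (2 * n - 1) + M)
    push_cast at this
    exact this

lemma polarPart_add_one (u : ℂ) : polarPart p j r τ (u + 1) = -polarPart p j r τ u := by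
  have h1 : ee (-((u + 1) / 2)) = -ee (-(u / 2)) := by
    rw [neg_ee, ← ee_add_int _ 1]; congr 1; push_cast; ring
  simp only [polarPart, polarSum, appellSum_add_one, h1]
  ring

lemma polarPart_add_two_mul (u : ℂ) : polarPart p j r τ (u + 2 * p * τ) =
    ee (-(p * j * τ) - j * u) * polarPart p j r τ u := by
  have h1 : ee (-((u + 2 * p * τ) / 2)) * ee ((p - j * p) * τ - j * u) =
      ee (-(p * j * τ) - j * u) * ee (-(u / 2)) := by
    rw [← ee_add, ← ee_add]; congr 1; ring
  have h2 : polarSum p j r τ (u + 2 * p * τ) =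
      ee ((p - j * p) * τ - j * u) * polarSum p j r τ u := by
    simp only [polarSum, appellSum_add_two_mul, mul_sum]
    exact sum_congr rfl fun m _ => by ring
  rw [polarPart, polarPart, h2, ← mul_assoc (ee _), h1]
  ring

/-- The character minus its polar part. -/
def regularPart (p j r : ℕ) (τ u : ℂ) : ℂ :=
  admChar p (2 * p + j) (2 * r + 1) u τ - polarPart p j r τ u

lemma regularPart_add_one (hp : 1 ≤ p) (hτ : 0 < τ.im) (u : ℂ) :
    regularPart p j r τ (u + 1) = -regularPart p j r τ u := by
  rw [regularPart, regularPart, admChar_add_one (by omega) hτ, polarPart_add_one]; ring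

lemma regularPart_add_two_mul (hp : 1 ≤ p) (hτ : 0 < τ.im) (u : ℂ) :
    regularPart p j r τ (u + 2 * p * τ) =
      ee (-(p * j * τ) - j * u) * regularPart p j r τ u := by
  rw [regularPart, regularPart, admChar_add_two_mul hp hτ, polarPart_add_two_mul]; ring

lemma differentiableAt_regularPart (hp : 1 ≤ p) (hj : 1 ≤ j) (hτ : 0 < τ.im) {c : ℂ}
    (hc : denTheta τ c ≠ 0) : DifferentiableAt ℂ (regularPart p j r τ) c :=
  (differentiableAt_admChar hp hτ hc).sub (differentiableAt_polarPart_of_denTheta hp hj hτ hc)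

/-- The residue at `z = q ^ e` of the Appell–Lerch sums in the polar part. -/
def polarResidue (p j : ℕ) (τ : ℂ) (e : ℤ) : ℂ :=
  ee ((j * p + p - j * e) * τ) / (2 * Real.pi * Complex.I)

lemma tendsto_sub_mul_polarSum (hp : 1 ≤ p) (hj : 1 ≤ j) (hτ : 0 < τ.im) {e : ℤ}
    (he0 : 0 ≤ e) (he : e < 2 * p) :
    Tendsto (fun u => (u - e * τ) * polarSum p j r τ u) (𝓝[≠] (e * τ))
      (𝓝 (∑ m ∈ Ico 1 p, polarCoeff p j r τ m *
        (ee ((m - p) * τ) * (if (m : ℤ) = e - p then polarResidue p j τ e else 0) -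
          ee ((-p - j * m) * τ) * (if (-m : ℤ) = e - p then polarResidue p j τ e else 0)))) := by
  have h : ∀ m ∈ Ico 1 p, Tendsto (fun u => (u - e * τ) * (polarCoeff p j r τ m *
      (ee ((m - p) * τ) * appellSum p j m τ u - ee ((-p - j * m) * τ) * appellSum p j (-m) τ u)))
      (𝓝[≠] (e * τ)) (𝓝 (polarCoeff p j r τ m *
        (ee ((m - p) * τ) * (if (m : ℤ) = e - p then polarResidue p j τ e else 0) -
          ee ((-p - j * m) * τ) * (if (-m : ℤ) = e - p then polarResidue p j τ e else 0)))) := by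
    intro m hm
    have hm' := mem_Ico.1 hm
    have h1 := tendsto_sub_mul_appellSum hp hj hτ (M := m) (e := e)
      (by rw [Nat.abs_cast]; exact_mod_cast hm'.2) he0 he
    have h2 := tendsto_sub_mul_appellSum hp hj hτ (M := -m) (e := e)
      (by rw [abs_neg, Nat.abs_cast]; exact_mod_cast hm'.2) he0 he
    refine (((h1.const_mul (ee ((m - p) * τ))).sub
      (h2.const_mul (ee ((-p - j * m) * τ)))).const_mul (polarCoeff p j r τ m)).congr fun u => ?_
    ring
  refine (tendsto_finsetSum _ h).congr fun u => ?_
  rw [polarSum, mul_sum]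

/-- The common shape of the two residue identities; `E` cancels. -/
lemma residue_algebra {E L P : ℂ} (hE : E ≠ 0) (hL : L ≠ 0) (hP : P ≠ 0)
    (x₁ x₂ x₃ x₄ x₅ x₆ x₇ T : ℂ) :
    E * (x₁ * x₂ * x₃ * x₄ * x₅ * x₆ * x₇) * T * (-P * E * L)⁻¹ =
      1 / L * (x₁ * x₂) * (x₃ * (x₄ * x₅ * T * -(x₆ * (x₇ / P)))) := by
  field_simp

/-- The residues of the character and of the polar part agree at `z = q ^ (p - m)`. -/
lemma residue_eq_sub (hτ : 0 < τ.im) {m : ℕ} {e : ℤ} (he : e = p - m) :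
    numTheta p (2 * p + j) r τ (e * τ) *
        (-(2 * Real.pi * Complex.I) * ee (τ / 8 + e / 2 - e ^ 2 * τ / 2) *
          qPochInf (ee τ) (ee τ) ^ 3)⁻¹ =
      polarConst p j r τ * (ee (-(e * τ / 2)) * (polarCoeff p j r τ m *
        -(ee ((-p - j * m) * τ) * polarResidue p j τ e))) := by
  have hec : (e : ℂ) = p - m := by rw [he]; push_cast; ring
  have hL := pow_ne_zero 3 (qPochInf_self_ne_zero (norm_ee_lt_one hτ))
  have hpi := Complex.two_pi_I_ne_zero
  rw [hec, numTheta_sub_mul, polarConst, polarCoeff, polarResidue, neg_one_pow_eq_ee,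
    neg_one_pow_eq_ee, hec]
  have key : ee ((p * (r + 1) ^ 2 / ((2 * p + j : ℕ) : ℂ) - (p - m) * (r + 1)) * τ) =
      ee (τ / 8 + (p - m) / 2 - (p - m) ^ 2 * τ / 2) * (ee (p / 2) *
        ee ((-(1 / 8) + p * (r + 1) ^ 2 / (2 * p + j) + (p * (p - 1) / 2 - p * r)) * τ) *
        ee (-((p - m) * τ / 2)) * ee (m / 2) * ee ((m * (m + 1) / 2 + m * (r - p)) * τ) *
        ee ((-p - j * m) * τ) * ee ((j * p + p - j * (p - m)) * τ)) := by
    simp only [← ee_add]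
    rw [← ee_add_int _ p]
    congr 1; push_cast; ring
  rw [key]
  exact residue_algebra (ee_ne_zero _) hL hpi _ _ _ _ _ _ _ _

/-- The residues of the character and of the polar part agree at `z = q ^ (p + m)`. -/
lemma residue_eq_add (hτ : 0 < τ.im) {m : ℕ} {e : ℤ} (he : e = p + m) :
    numTheta p (2 * p + j) r τ (e * τ) *
        (-(2 * Real.pi * Complex.I) * ee (τ / 8 + e / 2 - e ^ 2 * τ / 2) *
          qPochInf (ee τ) (ee τ) ^ 3)⁻¹ =
      polarConst p j r τ * (ee (-(e * τ / 2)) * (polarCoeff p j r τ m *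
        (ee ((m - p) * τ) * polarResidue p j τ e))) := by
  have hec : (e : ℂ) = p + m := by rw [he]; push_cast; ring
  have hL := pow_ne_zero 3 (qPochInf_self_ne_zero (norm_ee_lt_one hτ))
  have hpi := Complex.two_pi_I_ne_zero
  rw [hec, numTheta_add_mul, numTheta_sub_mul, polarConst, polarCoeff, polarResidue,
    neg_one_pow_eq_ee, neg_one_pow_eq_ee, hec, ← mul_assoc (ee _) (ee _), ← ee_add]
  have key : ee (-(m * ((2 * p + j : ℕ) : ℂ) * τ) +
        (p * (r + 1) ^ 2 / ((2 * p + j : ℕ) : ℂ) - (p - m) * (r + 1)) * τ) =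
      ee (τ / 8 + (p + m) / 2 - (p + m) ^ 2 * τ / 2) * (ee (p / 2) *
        ee ((-(1 / 8) + p * (r + 1) ^ 2 / (2 * p + j) + (p * (p - 1) / 2 - p * r)) * τ) *
        ee (-((p + m) * τ / 2)) * ee (m / 2) * ee ((m * (m + 1) / 2 + m * (r - p)) * τ) *
        ee ((m - p) * τ) * ee ((j * p + p - j * (p + m)) * τ)) := by
    simp only [← ee_add]
    rw [← ee_add_int _ (p + m)]
    congr 1; push_cast; ring
  rw [key]
  rw [neg_mul (_ * _) _⁻¹, residue_algebra (ee_ne_zero _) hL hpi]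
  ring

lemma tendsto_sub_mul_regularPart (hp : 1 ≤ p) (hj : 1 ≤ j) (hτ : 0 < τ.im) {e : ℤ}
    (he0 : 0 ≤ e) (he : e < 2 * p) :
    Tendsto (fun u => (u - e * τ) * regularPart p j r τ u) (𝓝[≠] (e * τ)) (𝓝 0) := by
  have h1 := tendsto_sub_mul_admChar (j := j) (r := r) hp hτ e
  have hc : Continuous fun u : ℂ => ee (-(u / 2)) := by fun_prop
  have h2 := (((hc.tendsto (e * τ)).mono_left nhdsWithin_le_nhds).mul
    (tendsto_sub_mul_polarSum (r := r) hp hj hτ he0 he)).const_mul (polarConst p j r τ)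
  have h3 := h1.sub h2
  have h4 : ∀ u, (u - e * τ) * admChar p (2 * p + j) (2 * r + 1) u τ -
      polarConst p j r τ * (ee (-(u / 2)) * ((u - e * τ) * polarSum p j r τ u)) =
      (u - e * τ) * regularPart p j r τ u := fun u => by
    rw [regularPart, polarPart]; ring
  simp only [h4] at h3
  convert h3 using 2
  symm
  rw [sub_eq_zero]
  -- for `e = 0` and `e = p` the numerator vanishes and no Appell–Lerch sum has a pole
  rcases lt_trichotomy e p with hlt | heq | hgt
  · rcases he0.eq_or_lt with h0 | h0
    · rw [← h0, Int.cast_zero, zero_mul, numTheta_zero, zero_mul, sum_eq_zero, mul_zero, mul_zero]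
      intro m hm
      have hm' := mem_Ico.1 hm
      rw [if_neg (by omega), if_neg (by omega)]; ring
    · obtain ⟨m, hm⟩ : ∃ m : ℕ, (m : ℤ) = p - e := ⟨(p - e).toNat, by omega⟩
      rw [residue_eq_sub hτ (m := m) (by omega), sum_eq_single m]
      · rw [if_neg (by omega), if_pos (by omega), mul_zero, zero_sub]
      · intro m' hm' hne
        have := mem_Ico.1 hm'
        rw [if_neg (by omega), if_neg (by omega)]; ring
      · intro h
        exact absurd (mem_Ico.2 ⟨by omega, by omega⟩) h
  · rw [heq, Int.cast_natCast, numTheta_mul_self, zero_mul, sum_eq_zero, mul_zero, mul_zero]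
    intro m hm
    have hm' := mem_Ico.1 hm
    rw [if_neg (by omega), if_neg (by omega)]; ring
  · obtain ⟨m, hm⟩ : ∃ m : ℕ, (m : ℤ) = e - p := ⟨(e - p).toNat, by omega⟩
    rw [residue_eq_add hτ (m := m) (by omega), sum_eq_single m]
    · rw [if_pos (by omega), if_neg (by omega), mul_zero, sub_zero]
    · intro m' hm' hne
      have := mem_Ico.1 hm'
      rw [if_neg (by omega), if_neg (by omega)]; ring
    · intro h
      exact absurd (mem_Ico.2 ⟨by omega, by omega⟩) h

/-- The regular part has only removable singularities. -/
lemma tendsto_sub_mul_regularPart_of_denTheta (hp : 1 ≤ p) (hj : 1 ≤ j) (hτ : 0 < τ.im) {c : ℂ}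
    (hc : denTheta τ c = 0) :
    Tendsto (fun u => (u - c) * regularPart p j r τ u) (𝓝[≠] c) (𝓝 0) := by
  obtain ⟨n, b, rfl⟩ := exists_eq_of_denTheta_eq_zero hτ hc
  have hP1 : IsQuasiPeriod (regularPart p j r τ) 1 :=
    ⟨fun _ => -1, continuous_const, fun _ => by norm_num, fun u => by
      rw [regularPart_add_one hp hτ, neg_one_mul]⟩
  have hP2 : IsQuasiPeriod (regularPart p j r τ) (2 * p * τ) :=
    ⟨fun u => ee (-(p * j * τ) - j * u), by fun_prop, fun u => ee_ne_zero _,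
      regularPart_add_two_mul hp hτ⟩
  have hP := (hP2.int_mul (n / (2 * p : ℤ))).add (hP1.int_mul b)
  have hpos : (0 : ℤ) < 2 * p := by omega
  have h := hP.tendsto_sub_mul (tendsto_sub_mul_regularPart (r := r) hp hj hτ
    (e := n % (2 * p : ℤ)) (Int.emod_nonneg _ hpos.ne') (Int.emod_lt_of_pos _ hpos))
  have e1 : ((n % (2 * p : ℤ) : ℤ) : ℂ) * τ + (((n / (2 * p : ℤ) : ℤ) : ℂ) * (2 * p * τ) + b * 1) =
      n * τ + b := by
    have h1 := Int.emod_add_mul_ediv n (2 * p)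
    have h2 : ((n % (2 * p : ℤ) : ℤ) : ℂ) + 2 * p * ((n / (2 * p : ℤ) : ℤ) : ℂ) = n := by
      exact_mod_cast congrArg (Int.cast (R := ℂ)) h1
    linear_combination τ * h2
  rwa [e1] at h

end poles

/-! ### Expansion of quasi-periodic entire functions -/

section entire

variable {p j : ℕ} {τ : ℂ} {f : ℂ → ℂ}

/-- Quasi-periodicity determines all Laurent coefficients from `j` consecutive ones. -/
lemma coeff_int_mul_sub {a : ℤ → ℂ}
    (ha : ∀ k : ℤ, a k * ee (2 * p * k * τ) = ee ((p - p * j) * τ) * a (k + j)) (s n : ℤ) :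
    a (n * j - s) = ee ((p * j * n ^ 2 - p * n * (2 * s + 1)) * τ) * a (-s) := by
  have hstep : ∀ n : ℤ, a ((n + 1) * j - s) =
      ee ((p * j * (2 * n + 1) - p * (2 * s + 1)) * τ) * a (n * j - s) := fun n => by
    have h := ha (n * j - s)
    rw [show n * j - s + (j : ℤ) = (n + 1) * j - s by ring] at h
    have h0 := ee_ne_zero ((p - p * j) * τ)
    have e : ee (2 * p * ((n * j - s : ℤ) : ℂ) * τ) =
        ee ((p - p * j) * τ) * ee ((p * j * (2 * n + 1) - p * (2 * s + 1)) * τ) := by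
      rw [← ee_add]; congr 1; push_cast; ring
    rw [e] at h
    refine mul_left_cancel₀ h0 ?_
    rw [← h]; ring
  induction n with
  | zero => simp [ee_zero]
  | succ n ih =>
    rw [hstep, ih, ← mul_assoc, ← ee_add]
    congr 2; push_cast; ring
  | pred n ih =>
    have h := hstep (-n - 1)
    rw [sub_add_cancel, ih] at h
    refine mul_left_cancel₀ (ee_ne_zero ((p * j * (2 * ((-n - 1 : ℤ) : ℂ) + 1) -
      p * (2 * s + 1)) * τ)) ?_
    rw [← h, ← mul_assoc, ← ee_add]
    congr 2; push_cast; ring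

/-- An entire function with the periodicity of a theta function of level `j` is a combination of
`j` theta functions, whose coefficients are Fourier coefficients. -/
theorem eq_sum_theta_of_quasiPeriodic (hp : 1 ≤ p) (hj : 1 ≤ j) (hτ : 0 < τ.im)
    (hf : Differentiable ℂ f) (h1 : ∀ u, f (u + 1) = f u)
    (h2 : ∀ u, f (u + 2 * p * τ) = ee ((p - p * j) * τ - j * u) * f u) (u : ℂ) :
    f u = ∑ s ∈ range j, (∫ x in (0 : ℝ)..1, f x * ee (s * x)) * ee (-(s * u)) *
      jacobiTheta₂ (j * u - p * (2 * s + 1) * τ) (2 * p * j * τ) := by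
  set a : ℤ → ℂ := fun k => ∫ x in (0 : ℝ)..1, f x * ee (-(k * x)) with ha
  have hsum : ∀ v : ℂ, HasSum (fun k : ℤ => a k * ee (k * v)) (f v) := fun v =>
    hasSum_fourier_strip (T := |v.im| + 1) hf.differentiableOn (fun w _ => h1 w)
      (lt_add_one _)
  -- compare the coefficients of the two expansions of `f (x + 2 p τ)`
  have hrec : ∀ k : ℤ, a k * ee (2 * p * k * τ) = ee ((p - p * j) * τ) * a (k + j) := fun k => by
    have hA := fourier_coeff_unique (c := fun k => a k * ee (2 * p * k * τ))
      (g := fun x => f (x + 2 * p * τ)) (fun x => by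
        refine (hsum (x + 2 * p * τ)).congr_fun fun k => ?_
        rw [mul_assoc, ← ee_add]; congr 2; ring) k
    have hB := fourier_coeff_unique (c := fun k => ee ((p - p * j) * τ) * a (k + j))
      (g := fun x => f (x + 2 * p * τ)) (fun x => by
        have h := ((Equiv.addRight (j : ℤ)).hasSum_iff.2 (hsum x)).mul_left
          (ee ((p - p * j) * τ - j * x))
        rw [← h2] at h
        refine h.congr_fun fun k => ?_
        rw [Function.comp, Equiv.coe_addRight, mul_right_comm, mul_left_comm (ee _) (a _),
          ← ee_add, ← ee_add, mul_comm (ee _) (a _)]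
        congr 2; push_cast; ring) k
    exact hA.trans hB.symm
  have him : 0 < (2 * p * j * τ : ℂ).im := by
    have := im_nat_mul_pos (n := 2 * p * j) (by nlinarith) hτ
    simpa using this
  have hs := hsum u
  rw [← (Equiv.neg ℤ).hasSum_iff] at hs
  rw [← hs.tsum_eq, tsum_eq_sum_tsum_mul_add hs.summable hj]
  refine sum_congr rfl fun s _ => ?_
  have has : a (-s) = ∫ x in (0 : ℝ)..1, f x * ee (s * x) := by
    simp [ha]
  rw [← has, ← jacobiTheta₂_neg_left, jacobiTheta₂_eq_tsum, ← tsum_mul_left]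
  refine tsum_congr fun n => ?_
  have h := coeff_int_mul_sub hrec s (-n)
  rw [Function.comp, Equiv.neg_apply, show -(n * (j : ℤ) + s) = -n * j - s by ring, h,
    mul_comm (ee _) (a _), mul_assoc (a _) (ee _), mul_assoc (a _) (ee _), ← ee_add, ← ee_add]
  congr 2; push_cast; ring

end entire

/-! ### The expansions of the character -/

section final

variable {p j r : ℕ} {τ : ℂ}

lemma denTheta_ofReal_ne_zero (hτ : 0 < τ.im) {x : ℝ} (hx0 : 0 < x) (hx1 : x < 1) :
    denTheta τ x ≠ 0 := by
  refine denTheta_ne_zero_of_im hτ (by simpa using hτ) fun h => ?_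
  obtain ⟨n, hn⟩ := (ee_eq_one_iff _).1 h
  have hn' : x = n := by exact_mod_cast hn
  rw [hn'] at hx0 hx1
  have h0 : 0 < n := by exact_mod_cast hx0
  have h1 : n < 1 := by exact_mod_cast hx1
  omega

/-- Endpoints do not matter: at `x = 0, 1` the character takes the junk value `0 / 0 = 0`. -/
lemma integral_congr_Ioo {f g : ℝ → ℂ} (h : ∀ x : ℝ, 0 < x → x < 1 → f x = g x) :
    ∫ x in (0 : ℝ)..1, f x = ∫ x in (0 : ℝ)..1, g x := by
  refine intervalIntegral.integral_congr_ae ?_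
  filter_upwards [MeasureTheory.Measure.ae_ne MeasureTheory.volume (1 : ℝ)] with x hx1 hx
  rw [Set.uIoc_of_le zero_le_one] at hx
  exact h x hx.1 (lt_of_le_of_ne hx.2 hx1)

/-- The string function times its power of `q` as an integral; here `4 N = 4 j / p`. -/
lemma stringFn_eq (hp : 1 ≤ p) (hj : 1 ≤ j) (m : ℤ) :
    stringFn p (2 * p + j) m (2 * r + 1) τ * ee (p * m ^ 2 / (4 * j) * τ) =
      ∫ x in (0 : ℝ)..1, admChar p (2 * p + j) (2 * r + 1) x τ * ee (m / 2 * x) := by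
  have hp0 : (p : ℂ) ≠ 0 := by
    have : p ≠ 0 := by omega
    exact_mod_cast this
  have hj0 : (j : ℂ) ≠ 0 := by
    have : j ≠ 0 := by omega
    exact_mod_cast this
  have hN : admLevel p (2 * p + j) = j / p := by
    rw [admLevel]; push_cast; field_simp; ring
  have e : ee (-((m : ℂ) ^ 2 / (4 * (j / p))) * τ) * ee (p * m ^ 2 / (4 * j) * τ) = 1 := by
    rw [← ee_add, ← ee_zero]; congr 1; field_simp; ring
  simp only [stringFn, epow_eq_ee, hN]
  rw [mul_right_comm, e, one_mul]

/-- The character has the Laurent expansion defining the string functions. -/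
theorem hasSum_admChar (hp : 1 ≤ p) (hj : 1 ≤ j) (hτ : 0 < τ.im) {u : ℂ} (hu : |u.im| < τ.im)
    (hu1 : ee u ≠ 1) :
    HasSum (fun k : ℤ => stringFn p (2 * p + j) (2 * k + 1) (2 * r + 1) τ *
      ee (p * (2 * k + 1) ^ 2 / (4 * j) * τ) * ee (-((2 * k + 1) / 2) * u))
      (admChar p (2 * p + j) (2 * r + 1) u τ) := by
  -- `G` is the character with its removable singularities at `z = 1` filled in
  set χ : ℂ → ℂ := fun u => admChar p (2 * p + j) (2 * r + 1) u τ with hχ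
  set G : ℂ → ℂ := fun z => limUnder (𝓝[≠] z) χ with hG
  have hGχ : ∀ z, denTheta τ z ≠ 0 → G z = χ z := fun z hz =>
    limUnder_eq_of_continuousAt (differentiableAt_admChar hp hτ hz).continuousAt
  have hdiff : ∀ z : ℂ, |z.im| < τ.im → DifferentiableAt ℂ G z := by
    intro z hz
    refine differentiableAt_limUnder ?_ ?_
    · filter_upwards [eventually_denTheta_ne_zero hτ z] with w hw
      exact differentiableAt_admChar hp hτ hw
    · by_cases h1 : ee z = 1
      · obtain ⟨b, rfl⟩ := (ee_eq_one_iff z).1 h1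
        have h0 := tendsto_sub_mul_admChar (j := j) (r := r) hp hτ 0
        simp only [Int.cast_zero, zero_mul, numTheta_zero] at h0
        have := ((isQuasiPeriod_admChar_one (j := j) (r := r) hp hτ).int_mul b).tendsto_sub_mul h0
        simpa only [mul_one, zero_add] using this
      · exact tendsto_sub_mul_of_continuousAt
          (differentiableAt_admChar hp hτ (denTheta_ne_zero_of_im hτ hz h1)).continuousAt
  have hper : ∀ z : ℂ, |z.im| < τ.im → G (z + 1) = -G z := by
    intro z hz
    have hz1 : |(z + 1).im| < τ.im := by simpa using hz
    have hc1 : ContinuousAt (fun w => G (w + 1)) z :=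
      ContinuousAt.comp (f := fun w : ℂ => w + 1) (hdiff _ hz1).continuousAt (by fun_prop)
    have hc2 : ContinuousAt (fun w => -G w) z := (hdiff z hz).continuousAt.neg
    refine tendsto_nhds_unique (hc1.tendsto.mono_left (nhdsWithin_le_nhds (s := {z}ᶜ)))
      ((hc2.tendsto.mono_left nhdsWithin_le_nhds).congr' ?_)
    filter_upwards [eventually_denTheta_ne_zero hτ z] with w hw
    have hw1 : denTheta τ (w + 1) ≠ 0 := by rw [denTheta_add_one hτ]; exact neg_ne_zero.2 hw
    rw [hGχ _ hw, hGχ _ hw1]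
    exact (admChar_add_one (by omega) hτ w).symm
  have h := hasSum_fourier_strip (T := τ.im) (h := fun z => G z * ee (z / 2))
    (fun z hz => ((hdiff z hz).mul (by fun_prop)).differentiableWithinAt)
    (fun z hz => by
      rw [hper z hz, show (z + 1) / 2 = z / 2 + 1 / 2 by ring, ee_add, ee_half]; ring) hu
  have h' := ((Equiv.neg ℤ).hasSum_iff.2 h).mul_right (ee (-(u / 2)))
  rw [mul_assoc, ← ee_add, add_neg_cancel, ee_zero, mul_one,
    hGχ u (denTheta_ne_zero_of_im hτ hu hu1)] at h'
  refine h'.congr_fun fun k => ?_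
  have hs := stringFn_eq (r := r) (τ := τ) hp hj (2 * k + 1)
  push_cast at hs
  rw [hs]
  have hint : ∫ x in (0 : ℝ)..1, G x * ee (x / 2) * ee (-(((-k : ℤ) : ℂ) * x)) =
      ∫ x in (0 : ℝ)..1, admChar p (2 * p + j) (2 * r + 1) x τ * ee ((2 * k + 1) / 2 * x) := by
    refine integral_congr_Ioo fun x hx0 hx1 => ?_
    rw [hGχ x (denTheta_ofReal_ne_zero hτ hx0 hx1), mul_assoc, ← ee_add]
    congr 2; push_cast; ring
  simp only [Function.comp, Equiv.neg_apply]
  rw [hint, mul_assoc, ← ee_add]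
  congr 2; push_cast; ring

lemma ee_sub_ofReal_ne_one (hp : 1 ≤ p) (hτ : 0 < τ.im) (x : ℝ) (M : ℤ) (hM : |M| < p)
    (n : ℤ) : ee ((p * (2 * n - 1) + M) * τ - x) ≠ 1 := by
  intro h
  have h2 := congrArg norm h
  rw [norm_ee, norm_one, Real.exp_eq_one_iff, appell_den_im, Complex.ofReal_im, sub_zero] at h2
  have hpi := Real.pi_pos
  have h3 : ((p * (2 * n - 1) + M : ℤ) : ℝ) = 0 := by
    have : (2 * Real.pi * τ.im) * ((p * (2 * n - 1) + M : ℤ) : ℝ) = 0 := by linarith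
    exact (mul_eq_zero.1 this).resolve_left (by positivity)
  have h4 : p * (2 * n - 1) + M = 0 := by exact_mod_cast h3
  rw [abs_lt] at hM
  have hp0 : (0 : ℤ) < p := by exact_mod_cast hp
  rcases lt_or_ge n 1 with h1 | h1 <;> nlinarith

/-- The polar part does not contribute to the Laurent coefficients at `z ^ (-(2 s + 1) / 2)`,
`0 ≤ s < j`. -/
lemma integral_polarPart (hp : 1 ≤ p) (hj : 1 ≤ j) (hτ : 0 < τ.im) {s : ℕ} (hs : s < j) :
    ∫ x in (0 : ℝ)..1, polarPart p j r τ x * ee (x / 2) * ee (s * x) = 0 := by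
  have hcont : ∀ M : ℤ, |M| < p → Continuous fun x : ℝ => appellSum p j M τ x := fun M hM =>
    continuous_iff_continuousAt.2 fun x =>
      ContinuousAt.comp (f := fun x : ℝ => (x : ℂ)) (differentiableAt_appellSum hp hj hτ M
        (ee_sub_ofReal_ne_one hp hτ x M hM)).continuousAt (by fun_prop)
  have e : ∀ x : ℝ, polarPart p j r τ x * ee (x / 2) * ee (s * x) =
      polarConst p j r τ * ∑ m ∈ Ico 1 p, polarCoeff p j r τ m *
        (ee ((m - p) * τ) * (appellSum p j m τ x * ee (s * x)) -
          ee ((-p - j * m) * τ) * (appellSum p j (-m) τ x * ee (s * x))) := fun x => by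
    have h1 : ee (-(x / 2 : ℂ)) * ee (x / 2) = 1 := by rw [← ee_add, neg_add_cancel, ee_zero]
    have h2 : ∑ m ∈ Ico 1 p, polarCoeff p j r τ m *
        (ee ((m - p) * τ) * (appellSum p j m τ x * ee (s * x)) -
          ee ((-p - j * m) * τ) * (appellSum p j (-m) τ x * ee (s * x))) =
        polarSum p j r τ x * ee (s * x) := by
      rw [polarSum, sum_mul]
      exact sum_congr rfl fun m _ => by ring
    rw [h2, polarPart]
    linear_combination polarConst p j r τ * polarSum p j r τ x * ee (s * x) * h1
  simp only [e]
  rw [intervalIntegral.integral_const_mul, intervalIntegral.integral_finsetSum]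
  · rw [sum_eq_zero, mul_zero]
    intro m hm
    have hm' := mem_Ico.1 hm
    have hM1 : |(m : ℤ)| < p := by rw [Nat.abs_cast]; exact_mod_cast hm'.2
    have hM2 : |(-m : ℤ)| < p := by rwa [abs_neg]
    have hc1 := hcont _ hM1
    have hc2 := hcont _ hM2
    rw [intervalIntegral.integral_const_mul, intervalIntegral.integral_sub,
      intervalIntegral.integral_const_mul, intervalIntegral.integral_const_mul,
      integral_appellSum_mul_ee hp hj hτ hM1 hs, integral_appellSum_mul_ee hp hj hτ hM2 hs]
    · ring
    · exact Continuous.intervalIntegrable (by fun_prop) _ _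
    · exact Continuous.intervalIntegrable (by fun_prop) _ _
  · intro m hm
    have hm' := mem_Ico.1 hm
    have hM1 : |(m : ℤ)| < p := by rw [Nat.abs_cast]; exact_mod_cast hm'.2
    have hM2 : |(-m : ℤ)| < p := by rwa [abs_neg]
    have hc1 := hcont _ hM1
    have hc2 := hcont _ hM2
    exact Continuous.intervalIntegrable (by fun_prop) _ _

/-- The polar-finite decomposition of the character. -/
theorem admChar_eq_add_polarPart (hp : 1 ≤ p) (hj : 1 ≤ j) (hτ : 0 < τ.im) {u : ℂ}
    (hu : denTheta τ u ≠ 0) :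
    admChar p (2 * p + j) (2 * r + 1) u τ =
      (∑ s ∈ range j, ee (-((2 * s + 1) / 2) * u) * ee (p * (2 * s + 1) ^ 2 / (4 * j) * τ) *
        stringFn p (2 * p + j) (2 * s + 1) (2 * r + 1) τ *
        jacobiTheta₂ (j * u - p * (2 * s + 1) * τ) (2 * p * j * τ)) + polarPart p j r τ u := by
  set F := regularPart p j r τ with hF
  set G : ℂ → ℂ := fun z => limUnder (𝓝[≠] z) F with hG
  have hGF : ∀ z, denTheta τ z ≠ 0 → G z = F z := fun z hz =>
    limUnder_eq_of_continuousAt (differentiableAt_regularPart hp hj hτ hz).continuousAt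
  have hdiff : Differentiable ℂ G := by
    intro z
    refine differentiableAt_limUnder ?_ ?_
    · filter_upwards [eventually_denTheta_ne_zero hτ z] with w hw
      exact differentiableAt_regularPart hp hj hτ hw
    · by_cases h1 : denTheta τ z = 0
      · exact tendsto_sub_mul_regularPart_of_denTheta hp hj hτ h1
      · exact tendsto_sub_mul_of_continuousAt
          (differentiableAt_regularPart hp hj hτ h1).continuousAt
  have hcont := hdiff.continuous
  -- the identities satisfied by `F` extend to `G` by continuity
  have hext : ∀ {φ ψ : ℂ → ℂ}, Continuous φ → Continuous ψ →
      (∀ z, denTheta τ z ≠ 0 → φ z = ψ z) → ∀ z, φ z = ψ z := by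
    intro φ ψ hφ hψ h z
    refine tendsto_nhds_unique ((hφ.tendsto z).mono_left (nhdsWithin_le_nhds (s := {z}ᶜ)))
      (((hψ.tendsto z).mono_left nhdsWithin_le_nhds).congr' ?_)
    filter_upwards [eventually_denTheta_ne_zero hτ z] with w hw
    exact (h w hw).symm
  have hG1 : ∀ z, G (z + 1) = -G z := hext (by fun_prop) (by fun_prop) fun z hz => by
    have hz1 : denTheta τ (z + 1) ≠ 0 := by rw [denTheta_add_one hτ]; exact neg_ne_zero.2 hz
    rw [hGF _ hz, hGF _ hz1, hF, regularPart_add_one hp hτ]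
  have hG2 : ∀ z, G (z + 2 * p * τ) = ee (-(p * j * τ) - j * z) * G z :=
    hext (by fun_prop) (by fun_prop) fun z hz => by
      have hz1 : denTheta τ (z + 2 * p * τ) ≠ 0 := by
        have h := denTheta_add_int_mul hτ z (2 * p)
        push_cast at h
        rw [h]
        exact mul_ne_zero (ee_ne_zero _) hz
      rw [hGF _ hz, hGF _ hz1, hF, regularPart_add_two_mul hp hτ]
  -- the factor `z ^ (1 / 2)` makes `G` periodic
  have hexp := eq_sum_theta_of_quasiPeriodic (f := fun z => G z * ee (z / 2)) hp hj hτ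
    (by fun_prop)
    (fun z => by
      rw [hG1, show (z + 1) / 2 = z / 2 + 1 / 2 by ring, ee_add, ee_half]; ring)
    (fun z => by
      rw [hG2, mul_right_comm, ← ee_add, mul_comm (G z) (ee _), ← mul_assoc, ← ee_add, mul_comm]
      rw [mul_comm]
      congr 2; ring) u
  have hcoef : ∀ s ∈ range j, ∫ x in (0 : ℝ)..1, G x * ee (x / 2) * ee (s * x) =
      stringFn p (2 * p + j) (2 * s + 1) (2 * r + 1) τ *
        ee (p * (2 * s + 1) ^ 2 / (4 * j) * τ) := by
    intro s hs
    have h1 := stringFn_eq (r := r) (τ := τ) hp hj (2 * s + 1)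
    push_cast at h1
    rw [h1]
    have hPc : Continuous fun x : ℝ => polarPart p j r τ x :=
      continuous_iff_continuousAt.2 fun x =>
        ContinuousAt.comp (f := fun x : ℝ => (x : ℂ)) (differentiableAt_polarPart hp hj hτ
          (ee_sub_ofReal_ne_one hp hτ x)).continuousAt (by fun_prop)
    have h2 : ∫ x in (0 : ℝ)..1, admChar p (2 * p + j) (2 * r + 1) x τ *
        ee ((2 * s + 1) / 2 * x) = ∫ x in (0 : ℝ)..1, (G x * ee (x / 2) * ee (s * x) +
          polarPart p j r τ x * ee (x / 2) * ee (s * x)) := by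
      refine integral_congr_Ioo fun x hx0 hx1 => ?_
      rw [hGF x (denTheta_ofReal_ne_zero hτ hx0 hx1), hF, regularPart,
        show ((2 * s + 1) / 2 * x : ℂ) = x / 2 + s * x by ring, ee_add]
      ring
    rw [h2, intervalIntegral.integral_add, integral_polarPart hp hj hτ (mem_range.1 hs), add_zero]
    · exact Continuous.intervalIntegrable (by fun_prop) _ _
    · exact Continuous.intervalIntegrable (by fun_prop) _ _
  have hFu : admChar p (2 * p + j) (2 * r + 1) u τ = G u + polarPart p j r τ u := by
    rw [hGF u hu, hF, regularPart]; ring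
  have hGu : G u = ee (-(u / 2)) * (G u * ee (u / 2)) := by
    rw [mul_left_comm, ← ee_add, neg_add_cancel, ee_zero, mul_one]
  rw [hFu, hGu, hexp, mul_sum]
  congr 1
  refine sum_congr rfl fun s hs => ?_
  rw [hcoef s hs]
  have e : ee (-((2 * s + 1) / 2) * u) = ee (-(u / 2)) * ee (-(s * u)) := by
    rw [← ee_add]; congr 1; ring
  rw [e]; ring

end final

end

theorem theorem2p2 (p j r : ℕ) (hp : 1 ≤ p) (hj : 1 ≤ j)
    (hcop : Nat.Coprime p (2 * p + j)) (hr : 2 * r + 1 + 2 ≤ 2 * p + j)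
    (τ : ℂ) (hτ : 0 < τ.im) :
    -- the Laurent expansion whose coefficients are the string functions,
    -- in the annulus `|q| < |z| < |q|⁻¹`
    (∀ u : ℂ, |u.im| < τ.im → epow u 1 ≠ 1 →
      HasSum (fun k : ℤ =>
          stringFn p (2 * p + j) (2 * k + 1) (2 * r + 1) τ *
            epow τ ((2 * (k : ℂ) + 1) ^ 2 / (4 * admLevel p (2 * p + j))) *
            epow u (-((2 * (k : ℂ) + 1) / 2)))
        (admChar p (2 * p + j) (2 * r + 1) u τ)) ∧
    -- the polar-finite decomposition, wherever all terms are defined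
    (∀ u : ℂ, (∀ n : ℤ, epow u 1 ≠ epow τ n) →
      (∀ s ∈ Finset.range j, ∀ m ∈ Finset.Ico 1 p,
        AppellDefined (-epow τ (j * m - p * (2 * s + 1)))
            (-epow τ (p * (j + 2 * s + 1)) * epow u (-j)) (epow τ (2 * j * p)) ∧
        AppellDefined (-epow τ (j * m + p * (2 * s + 1)))
            (-epow τ (p * (j - 2 * s - 1)) * epow u j) (epow τ (2 * j * p))) →
      admChar p (2 * p + j) (2 * r + 1) u τ =
        (∑ s ∈ Finset.range j,
          epow u (-((2 * s + 1) / 2)) * epow τ (p * (2 * s + 1) ^ 2 / (4 * j)) *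
            stringFn p (2 * p + j) (2 * s + 1) (2 * r + 1) τ *
            jTheta (-epow u j * epow τ (p * (j - 2 * s - 1))) (epow τ (2 * p * j))) +
        1 / qPochInf (epow τ 1) (epow τ 1) ^ 3 *
          ∑ s ∈ Finset.range j,
            (-1) ^ p * epow τ (-(1 / 8) + p * (2 * r + 2) ^ 2 / (4 * (2 * p + j))) *
              epow τ (p * (p - 1) / 2 - p * (r - s)) * epow u (-((2 * s + 1) / 2)) *
              jTheta (-epow τ (p * (j - 2 * s - 1)) * epow u j) (epow τ (2 * j * p)) *
              ∑ m ∈ Finset.Ico 1 p,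
                (-1) ^ m * epow τ (m * (m + 1) / 2 + m * (r - p)) *
                  (jTheta (-epow τ (m * (2 * p + j) + p * (2 * r + 2)))
                      (epow τ (2 * p * (2 * p + j))) -
                    epow τ (m * (2 * p + j) - m * (2 * r + 2)) *
                      jTheta (-epow τ (-(m * (2 * p + j)) + p * (2 * r + 2)))
                        (epow τ (2 * p * (2 * p + j)))) *
                  (epow τ (m * (s + 1) - p * (2 * s + 1)) *
                      appellM (-epow τ (j * m - p * (2 * s + 1)))
                        (-epow τ (p * (j + 2 * s + 1)) * epow u (-j)) (epow τ (2 * j * p)) +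
                    epow τ (-(m * s)) *
                      appellM (-epow τ (j * m + p * (2 * s + 1)))
                        (-epow τ (p * (j - 2 * s - 1)) * epow u j) (epow τ (2 * j * p)))) := by
  refine ⟨fun u hu hu1 => ?_, fun u hu hdef => ?_⟩
  · have hu1' : ee u ≠ 1 := by simpa only [epow_eq_ee, one_mul] using hu1
    have h := hasSum_admChar (r := r) hp hj hτ hu hu1'
    have hN : ∀ k : ℤ, (2 * (k : ℂ) + 1) ^ 2 / (4 * admLevel p (2 * p + j)) =
        p * (2 * k + 1) ^ 2 / (4 * j) := fun k => by
      have hp0 : (p : ℂ) ≠ 0 := Nat.cast_ne_zero.2 (by omega)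
      have hj0 : (j : ℂ) ≠ 0 := Nat.cast_ne_zero.2 (by omega)
      have hl : admLevel p (2 * p + j) = j / p := by
        rw [admLevel]; push_cast; field_simp; ring
      rw [hl]; field_simp
    simpa only [epow_eq_ee, hN] using h
  · rw [polarPart_eq hp hj hτ hdef]
    have hden : denTheta τ u ≠ 0 := denTheta_ne_zero hτ fun n hn => hu n (by
      rw [epow_eq_ee, epow_eq_ee, one_mul, hn, ee_zpow])
    rw [admChar_eq_add_polarPart hp hj hτ hden]
    have hT : 0 < (2 * p * j * τ : ℂ).im := by
      have := im_nat_mul_pos (n := 2 * p * j) (by nlinarith) hτ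
      simpa using this
    congr 1
    refine sum_congr rfl fun s _ => ?_
    simp only [epow_eq_ee]
    rw [neg_mul (ee _) (ee _), ← ee_add (j * u), jTheta_neg_eq_jacobiTheta₂ hT]
    congr 2
    ring
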